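/- Let $P(\lambda)\in\mathbb{C}[\lambda]^{m\times n}$ be a polynomial matrix of normal rank $r$ (its rank over $\mathbb{C}(\lambda)$), all of whose entries have degree at most $d$, and write $P(\lambda)=P_0+P_1\lambda+\dots+P_d\lambda^d$. Consider the $(dn+m)\times(d+1)n$ pencil $$S_\lambda=\left[\begin{array}{ccccc} I_n & -\lambda I_n & & & \\ & I_n & -\lambda I_n & & \\ & & \ddots & \ddots & \\ & & & I_n & -\lambda I_n \\ \hline P_d & \cdots & \cdots & P_1 & P_0\end{array}\right].$$ Then there exist unitary matrices $Q\in\mathbb{C}^{dn\times dn}$ and $Z\in\mathbb{C}^{(d+1)n\times(d+1)n}$ such that $$\left[\begin{array}{cc}Q^* & \\ & I_m\end{array}\right]S_\lambda Z=\left[\begin{array}{cccc} A_{11}-\lambda E_{11} & A_{12}-\lambda E_{12} & A_{13}-\lambda E_{13} & A_{14}-\lambda E_{14}\\ 0 & A_{22}-\lambda E_{22} & A_{23}-\lambda E_{23} & A_{24}-\lambda E_{24}\\ 0 & 0 & A_{33}-\lambda E_{33} & A_{34}-\lambda E_{34}\\ \hline 0&0&0&C_4\end{array}\right],$$ where all $A_{ij},E_{ij},C_4$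 are constant complex matrices, blocks may be empty, the last block row consists of the last $m$ rows, and the following holds. For $\varepsilon\ge 0$ let $L_\varepsilon$ be the $\varepsilon\times(\varepsilon+1)$ right Kronecker block with $\lambda$ on the diagonal and $1$ on the superdiagonal, and let $J_k(\alpha)$ be the $k\times k$ Jordan block with eigenvalue $\alpha$. Two pencils $M,N$ are strictly equivalent, $M\sim N$, if $UMV=N$ for constant invertible $U,V$. There are integers $\varepsilon_1,\dots,\varepsilon_{n-r}\ge 0$, $\eta_1,\dots,\eta_{m-r}\ge0$, finite zeros $\alpha_1,\dots,\alpha_f\in\mathbb{C}$ with partial multiplicities $k_1,\dots,k_f\ge1$, and degrees $l_1,\dots,l_g\ge1$ of infinite elementary divisors, such that $S_\lambda$ has the Kronecker canonical form $$S_\lambda\sim\bigoplus_{i=1}^{n-r}L_{\varepsilon_i}\ \oplus\ \bigoplus_{i=1}^{f}\bigl(J_{k_i}(\alpha_i)-\lambda I\bigr)\ \oplus\ \bigoplus_{i=1}^{g}\bigl(I-\lambda J_{l_i}(0)\bigr)\ \oplus\ \bigoplus_{i=1}^{m-r}L_{\eta_i}^T ,$$ and this structure is separated by the diagonal blocks: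 - $A_{22}-\lambda E_{22}$ is regular (square with $\det(A_{22}-\lambda E_{22})\not\equiv0$) and contains exactly the finite zeros of $S_\lambda$: $A_{22}-\lambda E_{22}\sim\bigoplus_{i}(J_{k_i}(\alpha_i)-\lambda I)$; - $A_{11}-\lambda E_{11}$ contains exactly the $n-r$ right Kronecker blocks of $S_\lambda$: $A_{11}-\lambda E_{11}\sim\bigoplus_iL_{\varepsilon_i}$; - the third diagonal block contains exactly the infinite zeros and the $m-r$ left Kronecker blocks of $S_\lambda$: $$\left[\begin{array}{cc}A_{33}-\lambda E_{33} & A_{34}-\lambda E_{34}\\ 0 & C_4\end{array}\right]\sim\bigoplus_{i}\bigl(I-\lambda J_{l_i}(0)\bigr)\ \oplus\ \bigoplus_{i}L_{\eta_i}^T;$$ - $C_4$ has full column rank. -/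

import Mathlib

open Polynomial Matrix

namespace KroneckerPencil

/-- The matrix pencil `A - λ E`, as a polynomial matrix. -/
noncomputable def pencil {ι κ : Type*} (A E : Matrix ι κ ℂ) : Matrix ι κ ℂ[X] :=
  A.map C - (X : ℂ[X]) • E.map C

/-- The normal rank of a polynomial matrix: its rank over the field of rational functions. -/
noncomputable def normalRank {ι κ : Type*} [Fintype κ] (M : Matrix ι κ ℂ[X]) : ℕ :=
  (M.map (algebraMap ℂ[X] (RatFunc ℂ))).rank

/-- Strict equivalence of polynomial matrices: `U M V = N` with constant invertible `U` and `V`,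
the rows and columns of `M` and `N` being matched by bijections. -/
def StrictEquiv {ι κ ι' κ' : Type*} [Fintype ι] [DecidableEq ι] [Fintype κ] [DecidableEq κ]
    (M : Matrix ι κ ℂ[X]) (N : Matrix ι' κ' ℂ[X]) : Prop :=
  ∃ (e : ι ≃ ι') (f : κ ≃ κ') (U : GL ι ℂ) (V : GL κ ℂ),
    (U : Matrix ι ι ℂ).map C * M * (V : Matrix κ κ ℂ).map C = N.submatrix e f

/-- The direct sum `M ⊕ N` of two rectangular polynomial matrices. -/
noncomputable def dsum {ι κ ι' κ' : Type*} (M : Matrix ι κ ℂ[X]) (N : Matrix ι' κ' ℂ[X]) :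
    Matrix (ι ⊕ ι') (κ ⊕ κ') ℂ[X] :=
  Matrix.fromBlocks M 0 0 N

/-- The right Kronecker block `L_ε`, of size `ε × (ε + 1)`, with `λ` on the diagonal and `1` on the
superdiagonal. For `ε = 0` it is a zero column. -/
noncomputable def rightBlock (ε : ℕ) : Matrix (Fin ε) (Fin (ε + 1)) ℂ[X] :=
  Matrix.of fun i j => if j = i.castSucc then X else if j = i.succ then 1 else 0

/-- The left Kronecker block `L_ηᵀ`, of size `(η + 1) × η`. For `η = 0` it is a zero row. -/
noncomputable def leftBlock (η : ℕ) : Matrix (Fin (η + 1)) (Fin η) ℂ[X] :=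
  (rightBlock η)ᵀ

/-- The `k × k` block `J_k(α) - λ I` of a finite zero `α` with elementary divisor `(λ - α) ^ k`. -/
noncomputable def finiteBlock (α : ℂ) (k : ℕ) : Matrix (Fin k) (Fin k) ℂ[X] :=
  Matrix.of fun i j => if j = i then C α - X else if (j : ℕ) = i + 1 then 1 else 0

/-- The `k × k` block `I - λ J_k(0)` of an infinite elementary divisor of degree `k`. -/
noncomputable def infiniteBlock (k : ℕ) : Matrix (Fin k) (Fin k) ℂ[X] :=
  Matrix.of fun i j => if j = i then 1 else if (j : ℕ) = i + 1 then -X else 0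

/-- `L_{ε₁} ⊕ ⋯ ⊕ L_{ε_a}`. -/
noncomputable def rightPart {a : ℕ} (ε : Fin a → ℕ) :
    Matrix (Σ i, Fin (ε i)) (Σ i, Fin (ε i + 1)) ℂ[X] :=
  Matrix.blockDiagonal' fun i => rightBlock (ε i)

/-- `L_{η₁}ᵀ ⊕ ⋯ ⊕ L_{η_b}ᵀ`. -/
noncomputable def leftPart {b : ℕ} (η : Fin b → ℕ) :
    Matrix (Σ i, Fin (η i + 1)) (Σ i, Fin (η i)) ℂ[X] :=
  Matrix.blockDiagonal' fun i => leftBlock (η i)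

/-- `(J_{k₁}(α₁) - λ I) ⊕ ⋯ ⊕ (J_{k_f}(α_f) - λ I)`. -/
noncomputable def finitePart {f : ℕ} (α : Fin f → ℂ) (k : Fin f → ℕ) :
    Matrix (Σ i, Fin (k i)) (Σ i, Fin (k i)) ℂ[X] :=
  Matrix.blockDiagonal' fun i => finiteBlock (α i) (k i)

/-- `(I - λ J_{l₁}(0)) ⊕ ⋯ ⊕ (I - λ J_{l_g}(0))`. -/
noncomputable def infinitePart {g : ℕ} (l : Fin g → ℕ) :
    Matrix (Σ i, Fin (l i)) (Σ i, Fin (l i)) ℂ[X] :=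
  Matrix.blockDiagonal' fun i => infiniteBlock (l i)

/-- The top `d` block rows of the system pencil: `I_n` in block position `(i, i)` and `-λ I_n` in
block position `(i, i + 1)`, for `i = 0, …, d - 1`; a block index comes first in each pair. -/
noncomputable def shiftBlocks (d n : ℕ) : Matrix (Fin d × Fin n) (Fin (d + 1) × Fin n) ℂ[X] :=
  Matrix.of fun a b =>
    if a.2 = b.2 then
      if b.1 = a.1.castSucc then 1 else if b.1 = a.1.succ then -X else 0
    else 0

/-- The bottom block row `[P_d ⋯ P_1 P_0]`, where `P_k` is the coefficient of `λ ^ k` in `P`. -/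
noncomputable def coeffBlocks (d : ℕ) {m n : ℕ} (P : Matrix (Fin m) (Fin n) ℂ[X]) :
    Matrix (Fin m) (Fin (d + 1) × Fin n) ℂ[X] :=
  Matrix.of fun i b => C ((P i b.2).coeff (b.1.rev : ℕ))

/-- The system pencil of size `(d n + m) × (d + 1) n`. -/
noncomputable def systemPencil (d : ℕ) {m n : ℕ} (P : Matrix (Fin m) (Fin n) ℂ[X]) :
    Matrix (Fin (d * n) ⊕ Fin m) (Fin ((d + 1) * n)) ℂ[X] :=
  (Matrix.fromRows (shiftBlocks d n) (coeffBlocks d P)).submatrix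
    (Equiv.sumCongr finProdFinEquiv.symm (Equiv.refl _)) finProdFinEquiv.symm

/-- Consecutive row groups of sizes `p₁, p₂, p₃` in the first `N = p₁ + p₂ + p₃` rows, followed by
a last group of `m` rows. -/
def rowSplit {p₁ p₂ p₃ N : ℕ} (m : ℕ) (h : p₁ + p₂ + p₃ = N) :
    (Fin p₁ ⊕ Fin p₂) ⊕ (Fin p₃ ⊕ Fin m) ≃ Fin N ⊕ Fin m :=
  (Equiv.sumAssoc _ _ _).symm.trans
    (Equiv.sumCongr
      (((Equiv.sumCongr finSumFinEquiv (Equiv.refl _)).trans finSumFinEquiv).trans (finCongr h))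
      (Equiv.refl _))

/-- Consecutive column groups of sizes `q₁, q₂, q₃, q₄`. -/
def colSplit {q₁ q₂ q₃ q₄ N : ℕ} (h : q₁ + q₂ + (q₃ + q₄) = N) :
    (Fin q₁ ⊕ Fin q₂) ⊕ (Fin q₃ ⊕ Fin q₄) ≃ Fin N :=
  ((Equiv.sumCongr finSumFinEquiv finSumFinEquiv).trans finSumFinEquiv).trans (finCongr h)

end KroneckerPencil

open KroneckerPencil

/-! The theorem combines three facts: every pencil has a Kronecker form, the numbers of right and
left blocks are fixed by the normal rank, and the form can be traded for unitary triangularity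
without touching the last `m` rows.

Existence (`hasKroneckerForm_pencil`) is by induction on size, splitting off one block at a time. A
chain `A x₀ = 0`, `A xⱼ₊₁ = E xⱼ` spans a copy of a block. It is a direct summand as soon as there
is a dual cochain `ψᵢ A = ψᵢ₊₁ E` with `ψ₀ E x₀ ≠ 0`, because the pairings `ψᵢ E xⱼ` then form an
invertible triangular Toeplitz matrix (`split_of_chain`). Taking a chain of extremal length supplies
the cochain by duality. Polynomial null vectors give the right blocks and, after transposition, the
left ones; without such vectors the pencil is regular and an eigenvector starts a Jordan chain,
finite or infinite.

Counting is linear algebra over the rational functions. The kernel of a Kronecker form has one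
dimension per right block. The kernel of the system pencil consists of the vectors `(λ^d y, …, λ y,
y)` with `P y = 0`, so there are `n - r` right blocks; comparing rows with columns then gives `m -
r` left blocks.

For the unitary step, write `S V = Y K` with `K` the Kronecker form. The last `m` rows of `S`
contain no `λ`, while each row of the right and finite parts of `K` is the only one carrying `λ` in
some column. Hence the columns of `Y` belonging to these parts vanish in the last `m` rows
(`last_rows_eq_zero`), and a QR factorization of the upper rows alone triangularizes `Y`. On the
column side, a QR factorization of `V` preserves the flag of leading columns. Refining the trailing
columns by the kernel of the constant rows isolates `C₄`, injective by construction
(`exists_unitary_blockTriangular`). -/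

set_option linter.unusedSectionVars false

namespace KroneckerPencil

/-! ### Strict equivalence between differently indexed matrices, and direct sums -/

section ConstEquiv

variable {ι κ ι' κ' ι'' κ'' : Type*}

/-- Strict equivalence by possibly rectangular index types: `U M V = N` where `U` and `V` are
constant matrices with two-sided inverses. -/
def ConstEquiv [Fintype ι] [DecidableEq ι] [Fintype κ] [DecidableEq κ]
    [Fintype ι'] [DecidableEq ι'] [Fintype κ'] [DecidableEq κ']
    (M : Matrix ι κ ℂ[X]) (N : Matrix ι' κ' ℂ[X]) : Prop :=
  ∃ (U : Matrix ι' ι ℂ) (U' : Matrix ι ι' ℂ) (V : Matrix κ κ' ℂ) (V' : Matrix κ' κ ℂ),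
    U * U' = 1 ∧ U' * U = 1 ∧ V * V' = 1 ∧ V' * V = 1 ∧ U.map C * M * V.map C = N

theorem map_C_mul [Fintype κ] (A : Matrix ι κ ℂ) (B : Matrix κ κ' ℂ) :
    (A * B).map C = A.map C * B.map (C : ℂ →+* ℂ[X]) :=
  Matrix.map_mul

theorem map_C_one [DecidableEq ι] : (1 : Matrix ι ι ℂ).map (C : ℂ →+* ℂ[X]) = 1 :=
  Matrix.map_one _ C_0 C_1

theorem map_C_zero : (0 : Matrix ι κ ℂ).map (C : ℂ →+* ℂ[X]) = 0 :=
  Matrix.map_zero _ C_0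

variable [Fintype ι] [DecidableEq ι] [Fintype κ] [DecidableEq κ]
    [Fintype ι'] [DecidableEq ι'] [Fintype κ'] [DecidableEq κ']
    [Fintype ι''] [DecidableEq ι''] [Fintype κ''] [DecidableEq κ'']

namespace ConstEquiv

theorem symm {M : Matrix ι κ ℂ[X]} {N : Matrix ι' κ' ℂ[X]} (h : ConstEquiv M N) :
    ConstEquiv N M := by
  obtain ⟨U, U', V, V', h1, h2, h3, h4, rfl⟩ := h
  refine ⟨U', U, V', V, h2, h1, h4, h3, ?_⟩
  have e1 : U'.map C * U.map (C : ℂ →+* ℂ[X]) = 1 := by rw [← map_C_mul, h2, map_C_one]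
  have e2 : V.map C * V'.map (C : ℂ →+* ℂ[X]) = 1 := by rw [← map_C_mul, h3, map_C_one]
  calc _ = (U'.map C * U.map C) * M * (V.map C * V'.map C) := by simp only [Matrix.mul_assoc]
    _ = M := by rw [e1, e2]; simp

theorem trans {M : Matrix ι κ ℂ[X]} {N : Matrix ι' κ' ℂ[X]} {L : Matrix ι'' κ'' ℂ[X]}
    (h : ConstEquiv M N) (h' : ConstEquiv N L) : ConstEquiv M L := by
  obtain ⟨U, U', V, V', h1, h2, h3, h4, rfl⟩ := h
  obtain ⟨W, W', Y, Y', g1, g2, g3, g4, rfl⟩ := h'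
  refine ⟨W * U, U' * W', V * Y, Y' * V', ?_, ?_, ?_, ?_, ?_⟩
  · rw [Matrix.mul_assoc, ← Matrix.mul_assoc U, h1, Matrix.one_mul, g1]
  · rw [Matrix.mul_assoc, ← Matrix.mul_assoc W', g2, Matrix.one_mul, h2]
  · rw [Matrix.mul_assoc, ← Matrix.mul_assoc Y, g3, Matrix.one_mul, h3]
  · rw [Matrix.mul_assoc, ← Matrix.mul_assoc V', h4, Matrix.one_mul, g4]
  · simp only [map_C_mul, Matrix.mul_assoc]

theorem of_reindex (M : Matrix ι κ ℂ[X]) (e : ι' ≃ ι) (f : κ' ≃ κ) :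
    ConstEquiv M (M.submatrix e f) := by
  refine ⟨(1 : Matrix ι ι ℂ).submatrix e id, (1 : Matrix ι ι ℂ).submatrix id e,
    (1 : Matrix κ κ ℂ).submatrix id f, (1 : Matrix κ κ ℂ).submatrix f id, ?_, ?_, ?_, ?_, ?_⟩
  · rw [← Matrix.submatrix_mul _ _ e id e Function.bijective_id]; simp
  · rw [← Matrix.submatrix_mul _ _ id e id e.bijective]; simp
  · rw [← Matrix.submatrix_mul _ _ id f id f.bijective]; simp
  · rw [← Matrix.submatrix_mul _ _ f id f Function.bijective_id]; simp
  · ext i j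
    simp [Matrix.mul_apply, Matrix.one_apply, apply_ite C]

theorem transpose {M : Matrix ι κ ℂ[X]} {N : Matrix ι' κ' ℂ[X]} (h : ConstEquiv M N) :
    ConstEquiv Mᵀ Nᵀ := by
  obtain ⟨U, U', V, V', h1, h2, h3, h4, rfl⟩ := h
  refine ⟨Vᵀ, V'ᵀ, Uᵀ, U'ᵀ, ?_, ?_, ?_, ?_, ?_⟩
  · rw [← Matrix.transpose_mul, h4, Matrix.transpose_one]
  · rw [← Matrix.transpose_mul, h3, Matrix.transpose_one]
  · rw [← Matrix.transpose_mul, h2, Matrix.transpose_one]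
  · rw [← Matrix.transpose_mul, h1, Matrix.transpose_one]
  · simp only [Matrix.transpose_mul, Matrix.transpose_map, Matrix.mul_assoc]

theorem dsum_congr {M : Matrix ι κ ℂ[X]} {N : Matrix ι' κ' ℂ[X]} (h : ConstEquiv M N)
    {ι₁ κ₁ ι₂ κ₂ : Type*} [Fintype ι₁] [DecidableEq ι₁] [Fintype κ₁] [DecidableEq κ₁]
    [Fintype ι₂] [DecidableEq ι₂] [Fintype κ₂] [DecidableEq κ₂]
    {M₁ : Matrix ι₁ κ₁ ℂ[X]} {N₁ : Matrix ι₂ κ₂ ℂ[X]} (h₁ : ConstEquiv M₁ N₁) :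
    ConstEquiv (dsum M M₁) (dsum N N₁) := by
  obtain ⟨U, U', V, V', h1, h2, h3, h4, rfl⟩ := h
  obtain ⟨W, W', Y, Y', g1, g2, g3, g4, rfl⟩ := h₁
  refine ⟨fromBlocks U 0 0 W, fromBlocks U' 0 0 W', fromBlocks V 0 0 Y, fromBlocks V' 0 0 Y',
    ?_, ?_, ?_, ?_, ?_⟩
  · simp [fromBlocks_multiply, *]
  · simp [fromBlocks_multiply, *]
  · simp [fromBlocks_multiply, *]
  · simp [fromBlocks_multiply, *]
  · simp [fromBlocks_multiply, fromBlocks_map, dsum]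

theorem card_eq {M : Matrix ι κ ℂ[X]} {N : Matrix ι' κ' ℂ[X]} (h : ConstEquiv M N) :
    Fintype.card ι = Fintype.card ι' ∧ Fintype.card κ = Fintype.card κ' := by
  obtain ⟨U, U', V, V', h1, h2, h3, h4, rfl⟩ := h
  exact ⟨(Matrix.square_of_invertible U' U h2 h1), (Matrix.square_of_invertible V V' h3 h4)⟩

/-- Invertibility forces equal cardinalities, so arbitrary bijections of the index types exist, and
the permutations they cause are absorbed into `U` and `V`. -/
theorem strictEquiv {M : Matrix ι κ ℂ[X]} {N : Matrix ι' κ' ℂ[X]} (h : ConstEquiv M N) :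
    StrictEquiv M N := by
  obtain ⟨hι, hκ⟩ := h.card_eq
  obtain ⟨e⟩ := Fintype.card_eq.mp hι
  obtain ⟨f⟩ := Fintype.card_eq.mp hκ
  obtain ⟨U, U', V, V', h1, h2, h3, h4, hN⟩ := h.trans (of_reindex N e f)
  exact ⟨e, f, ⟨U, U', h1, h2⟩, ⟨V, V', h3, h4⟩, hN⟩

end ConstEquiv

theorem dsum_dsum_comm {ι₁ ι₂ ι₃ ι₄ κ₁ κ₂ κ₃ κ₄ : Type*}
    [Fintype ι₁] [DecidableEq ι₁] [Fintype κ₁] [DecidableEq κ₁]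
    [Fintype ι₂] [DecidableEq ι₂] [Fintype κ₂] [DecidableEq κ₂]
    [Fintype ι₃] [DecidableEq ι₃] [Fintype κ₃] [DecidableEq κ₃]
    [Fintype ι₄] [DecidableEq ι₄] [Fintype κ₄] [DecidableEq κ₄]
    (M₁ : Matrix ι₁ κ₁ ℂ[X]) (M₂ : Matrix ι₂ κ₂ ℂ[X])
    (M₃ : Matrix ι₃ κ₃ ℂ[X]) (M₄ : Matrix ι₄ κ₄ ℂ[X]) :
    ConstEquiv (dsum (dsum M₁ M₂) (dsum M₃ M₄)) (dsum (dsum M₁ M₃) (dsum M₂ M₄)) := by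
  convert ConstEquiv.of_reindex (dsum (dsum M₁ M₂) (dsum M₃ M₄))
    (Equiv.sumSumSumComm ι₁ ι₃ ι₂ ι₄) (Equiv.sumSumSumComm κ₁ κ₃ κ₂ κ₄) using 1
  ext i j
  rcases i with (i | i) | (i | i) <;> rcases j with (j | j) | (j | j) <;> simp [dsum]

/-- Direct sums of families of blocks are concatenated. -/
theorem dsum_blockDiagonal' {T : Type*} {r c : T → ℕ}
    (F : ∀ t, Matrix (Fin (r t)) (Fin (c t)) ℂ[X]) {a b : ℕ} (x : Fin a → T) (y : Fin b → T) :
    ∃ z : Fin (a + b) → T, (∀ p : T → Prop, (∀ i, p (x i)) → (∀ i, p (y i)) → ∀ i, p (z i)) ∧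
      ConstEquiv (dsum (blockDiagonal' fun i => F (x i)) (blockDiagonal' fun i => F (y i)))
        (blockDiagonal' fun i => F (z i)) := by
  refine ⟨fun i => Sum.elim x y (finSumFinEquiv.symm i), fun p hx hy i => ?_, ?_⟩
  · dsimp only
    rcases finSumFinEquiv.symm i with j | j
    · exact hx j
    · exact hy j
  let er := (Equiv.sigmaCongrLeft' (β := fun i => Fin (r (Sum.elim x y i)))
    (finSumFinEquiv (m := a) (n := b))).symm.trans
      (Equiv.sumSigmaDistrib fun i => Fin (r (Sum.elim x y i)))
  let ec := (Equiv.sigmaCongrLeft' (β := fun i => Fin (c (Sum.elim x y i)))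
    (finSumFinEquiv (m := a) (n := b))).symm.trans
      (Equiv.sumSigmaDistrib fun i => Fin (c (Sum.elim x y i)))
  have key : (blockDiagonal' fun i => F (Sum.elim x y (finSumFinEquiv.symm i))) =
      (dsum (blockDiagonal' fun i => F (x i)) (blockDiagonal' fun i => F (y i))).submatrix
        er ec := by
    -- The comparison is made over `Fin a ⊕ Fin b`, where a case split makes `Sum.elim` reduce and
    -- no casts between dependent block sizes appear.
    have key' : ∀ i i' (j : Fin (r (Sum.elim x y i))) (j' : Fin (c (Sum.elim x y i'))),
        blockDiagonal' (fun i => F (Sum.elim x y i)) ⟨i, j⟩ ⟨i', j'⟩ =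
        (dsum (blockDiagonal' fun i => F (x i)) (blockDiagonal' fun i => F (y i)))
          ((Equiv.sumSigmaDistrib fun i => Fin (r (Sum.elim x y i))) ⟨i, j⟩)
          ((Equiv.sumSigmaDistrib fun i => Fin (c (Sum.elim x y i))) ⟨i', j'⟩) := by
      rintro (i | i) (i' | i') j j'
      · by_cases h : i = i'
        · subst h
          exact (blockDiagonal'_apply_eq _ _ _ _).trans
            (blockDiagonal'_apply_eq (fun i => F (x i)) i j j').symm
        · exact (blockDiagonal'_apply_ne _ _ _ (by simpa using h)).trans
            (blockDiagonal'_apply_ne (fun i => F (x i)) j j' h).symm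
      · exact blockDiagonal'_apply_ne _ _ _ (by simp)
      · exact blockDiagonal'_apply_ne _ _ _ (by simp)
      · by_cases h : i = i'
        · subst h
          exact (blockDiagonal'_apply_eq _ _ _ _).trans
            (blockDiagonal'_apply_eq (fun i => F (y i)) i j j').symm
        · exact (blockDiagonal'_apply_ne _ _ _ (by simpa using h)).trans
            (blockDiagonal'_apply_ne (fun i => F (y i)) j j' h).symm
    refine Matrix.ext fun ⟨i, j⟩ ⟨i', j'⟩ => ?_
    refine Eq.trans ?_ (key' (finSumFinEquiv.symm i) (finSumFinEquiv.symm i') j j')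
    by_cases h : i = i'
    · subst h
      rw [blockDiagonal'_apply_eq, blockDiagonal'_apply_eq]
    · rw [blockDiagonal'_apply_ne _ _ _ h, blockDiagonal'_apply_ne]
      exact fun h' => h (finSumFinEquiv.symm.injective h')
  rw [key]
  exact ConstEquiv.of_reindex _ er ec

end ConstEquiv

/-! ### Direct summands of a pencil -/

section Splitting

variable {ι κ : Type*} [Fintype ι] [DecidableEq ι] [Fintype κ] [DecidableEq κ]

/-- A constant column transformation separates the kernel of a matrix from a complement. -/
theorem exists_column_compression (A : Matrix ι κ ℂ) :
    ∃ (a b : ℕ) (J : Matrix κ (Fin a) ℂ) (H : Matrix κ (Fin b) ℂ)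
      (J' : Matrix (Fin a) κ ℂ) (H' : Matrix (Fin b) κ ℂ),
      fromCols J H * fromRows J' H' = 1 ∧ fromRows J' H' * fromCols J H = 1 ∧
      A * J = 0 ∧ ∀ x, (A * H) *ᵥ x = 0 → x = 0 := by
  obtain ⟨W, hW⟩ := (LinearMap.ker A.mulVecLin).exists_isCompl
  let bk := Module.finBasis ℂ (LinearMap.ker A.mulVecLin)
  let bw := Module.finBasis ℂ W
  -- A basis adapted to the kernel and a complement; its coordinate matrix is `[J H]`.
  let b := (bk.prod bw).map (Submodule.prodEquivOfIsCompl _ _ hW)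
  let G := (Pi.basisFun ℂ κ).toMatrix b
  let G' := b.toMatrix (Pi.basisFun ℂ κ)
  have h1 : G * G' = 1 := Module.Basis.toMatrix_mul_toMatrix_flip _ _
  have h2 : G' * G = 1 := Module.Basis.toMatrix_mul_toMatrix_flip _ _
  have hG : fromCols G.toCols₁ G.toCols₂ = G := fromCols_toCols _
  have hG' : fromRows G'.toRows₁ G'.toRows₂ = G' := fromRows_toRows _
  have hJ : ∀ j, (fun i => G i (Sum.inl j)) = (bk j : κ → ℂ) := fun j => by
    funext i
    simp [G, b, Module.Basis.toMatrix_apply]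
  have hH : ∀ j, (fun i => G i (Sum.inr j)) = (bw j : κ → ℂ) := fun j => by
    funext i
    simp [G, b, Module.Basis.toMatrix_apply]
  refine ⟨_, _, G.toCols₁, G.toCols₂, G'.toRows₁, G'.toRows₂, by rw [hG, hG', h1],
    by rw [hG, hG', h2], ?_, fun x hx => ?_⟩
  · ext i j
    have : A *ᵥ (bk j : κ → ℂ) = 0 := (bk j).2
    rw [← hJ] at this
    exact congrFun this i
  · rw [← Matrix.mulVec_mulVec] at hx
    have hx2 : G.toCols₂ *ᵥ x = ((∑ j, x j • bw j : W) : κ → ℂ) := by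
      funext i
      have : ∀ j, (bw j : κ → ℂ) i = G i (Sum.inr j) := fun j => (congrFun (hH j) i).symm
      calc (G.toCols₂ *ᵥ x) i = ∑ j, G i (Sum.inr j) * x j := rfl
        _ = ∑ j, x j * (bw j : κ → ℂ) i :=
          Finset.sum_congr rfl fun j _ => by rw [this, mul_comm]
        _ = _ := by simp
    have hmem : G.toCols₂ *ᵥ x ∈ LinearMap.ker A.mulVecLin ⊓ W :=
      ⟨hx, hx2 ▸ Submodule.coe_mem _⟩
    rw [hW.inf_eq_bot, Submodule.mem_bot, hx2] at hmem
    have := Fintype.linearIndependent_iff.mp bw.linearIndependent x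
      (Submodule.coe_eq_zero.mp hmem)
    exact funext this

/-- A left inverse extends to a splitting of the identity. -/
theorem exists_complement {b : ℕ} (P : Matrix (Fin b) κ ℂ) (I : Matrix κ (Fin b) ℂ)
    (hPI : P * I = 1) :
    ∃ (q : ℕ) (J : Matrix κ (Fin q) ℂ) (J' : Matrix (Fin q) κ ℂ), b + q = Fintype.card κ ∧
      fromRows P J' * fromCols I J = 1 ∧ fromCols I J * fromRows P J' = 1 ∧
      P * J = 0 ∧ J' * I = 0 := by
  obtain ⟨a, b', J, H, J', H', h1, h2, h3, h4⟩ := exists_column_compression P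
  -- As `P` kills `J`, the identity `P * I = 1` factors through the complement `H`. Together with
  -- injectivity of `P * H` this forces `b' = b`.
  have hPH : P * H * (H' * I) = 1 := by
    have : J * J' + H * H' = 1 := by rw [← h1, fromCols_mul_fromRows]
    calc P * H * (H' * I) = P * (H * H') * I := by simp only [Matrix.mul_assoc]
      _ = P * (1 - J * J') * I := by rw [← this]; simp
      _ = 1 := by rw [Matrix.mul_sub, ← Matrix.mul_assoc, h3]; simpa using hPI
  have hle : b' ≤ b := by
    have := card_le_of_injective ℂ (P * H).mulVecLin
      ((injective_iff_map_eq_zero _).mpr h4)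
    simpa using this
  have hge : b ≤ b' := by
    have := card_le_of_injective ℂ (H' * I).mulVecLin
      (Function.LeftInverse.injective (g := (P * H).mulVecLin) fun x => by
        rw [Matrix.mulVecLin_apply, Matrix.mulVecLin_apply, Matrix.mulVec_mulVec, hPH,
          Matrix.one_mulVec])
    simpa using this
  have hcard : a + b' = Fintype.card κ := by
    have := Matrix.square_of_invertible _ _ h1 h2
    simpa using this.symm
  have hJJ : J' * J = 1 := by
    have : fromBlocks (J' * J) (J' * H) (H' * J) (H' * H) = 1 := by
      rw [← h2, fromRows_mul_fromCols]
    rw [← fromBlocks_one] at this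
    exact (fromBlocks_inj.mp this).1
  -- The factor `1 - I * P` is the projection along the range of `I`; it makes the complementary
  -- coordinates vanish on `I` and leaves them unchanged on `J`, the kernel of `P`.
  have hJI : (J' * (1 - I * P)) * I = 0 := by
    rw [Matrix.mul_assoc, Matrix.sub_mul, Matrix.mul_assoc, hPI]; simp
  have hJJ2 : (J' * (1 - I * P)) * J = 1 := by
    rw [Matrix.mul_assoc, Matrix.sub_mul, Matrix.mul_assoc, h3]; simp [hJJ]
  have hone : fromRows P (J' * (1 - I * P)) * fromCols I J = 1 := by
    rw [fromRows_mul_fromCols, hPI, h3, hJI, hJJ2, fromBlocks_one]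
  refine ⟨a, J, J' * (1 - I * P), by omega, hone, ?_, h3, hJI⟩
  exact (Matrix.mul_eq_one_comm_of_card_eq _ _ _ (by simp; omega)).mp hone

theorem map_C_mul_smul_add_smul_mul {ι' κ' : Type*} (U : Matrix ι' ι ℂ) (V : Matrix κ κ' ℂ)
    (A E : Matrix ι κ ℂ) (z₀ z₁ : ℂ[X]) :
    U.map C * (z₀ • A.map C + z₁ • E.map C) * V.map C =
      z₀ • (U * A * V).map C + z₁ • (U * E * V).map C := by
  simp [Matrix.mul_add, Matrix.add_mul]

/-- A homomorphism from a block into a pencil, with a left inverse, splits off the block. -/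
theorem split_of_retraction {p q : ℕ} (z₀ z₁ : ℂ[X]) {A E : Matrix ι κ ℂ}
    {S D : Matrix (Fin p) (Fin q) ℂ}
    {Iv : Matrix κ (Fin q) ℂ} {Iw : Matrix ι (Fin p) ℂ}
    {Pv : Matrix (Fin q) κ ℂ} {Pw : Matrix (Fin p) ι ℂ}
    (hAI : A * Iv = Iw * S) (hEI : E * Iv = Iw * D) (hPA : Pw * A = S * Pv)
    (hPE : Pw * E = D * Pv) (hv : Pv * Iv = 1) (hw : Pw * Iw = 1) :
    ∃ (p' q' : ℕ) (A' E' : Matrix (Fin p') (Fin q') ℂ),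
      p + p' = Fintype.card ι ∧ q + q' = Fintype.card κ ∧
      ConstEquiv (z₀ • A.map C + z₁ • E.map C)
        (dsum (z₀ • S.map C + z₁ • D.map C) (z₀ • A'.map C + z₁ • E'.map C)) := by
  obtain ⟨q', Jv, Jv', hq, hv1, hv2, hv3, hv4⟩ := exists_complement Pv Iv hv
  obtain ⟨p', Jw, Jw', hp, hw1, hw2, hw3, hw4⟩ := exists_complement Pw Iw hw
  refine ⟨p', q', Jw' * A * Jv, Jw' * E * Jv, hp, hq, fromRows Pw Jw', fromCols Iw Jw,
    fromCols Iv Jv, fromRows Pv Jv', hw1, hw2, hv2, hv1, ?_⟩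
  have key : ∀ (A : Matrix ι κ ℂ) (S : Matrix (Fin p) (Fin q) ℂ), A * Iv = Iw * S →
      Pw * A = S * Pv →
      fromRows Pw Jw' * A * fromCols Iv Jv = fromBlocks S 0 0 (Jw' * A * Jv) := by
    intro A S h1 h2
    rw [fromRows_mul, fromRows_mul_fromCols]
    congr 1
    · rw [Matrix.mul_assoc, h1, ← Matrix.mul_assoc, hw, Matrix.one_mul]
    · rw [h2, Matrix.mul_assoc, hv3, Matrix.mul_zero]
    · rw [Matrix.mul_assoc, h1, ← Matrix.mul_assoc, hw4, Matrix.zero_mul]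
  rw [map_C_mul_smul_add_smul_mul, key A S hAI hPA, key E D hEI hPE]
  simp [dsum, fromBlocks_map, fromBlocks_smul, fromBlocks_add]

/-- Invertible pairings suffice in place of exact left inverses. The inclusions are corrected by the
inverse pairings and still intertwine the pencils, because `S * (Pv * Iv) = Pw * A * Iv = (Pw * Iv)
* S` in the appropriate spaces, and likewise for `D`. -/
theorem split_of_isUnit {p q : ℕ} (z₀ z₁ : ℂ[X]) {A E : Matrix ι κ ℂ}
    {S D : Matrix (Fin p) (Fin q) ℂ}
    {Iv : Matrix κ (Fin q) ℂ} {Iw : Matrix ι (Fin p) ℂ}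
    {Pv : Matrix (Fin q) κ ℂ} {Pw : Matrix (Fin p) ι ℂ}
    (hAI : A * Iv = Iw * S) (hEI : E * Iv = Iw * D) (hPA : Pw * A = S * Pv)
    (hPE : Pw * E = D * Pv) (hv : (Pv * Iv).det ≠ 0) (hw : (Pw * Iw).det ≠ 0) :
    ∃ (p' q' : ℕ) (A' E' : Matrix (Fin p') (Fin q') ℂ),
      p + p' = Fintype.card ι ∧ q + q' = Fintype.card κ ∧
      ConstEquiv (z₀ • A.map C + z₁ • E.map C)
        (dsum (z₀ • S.map C + z₁ • D.map C) (z₀ • A'.map C + z₁ • E'.map C)) := by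
  have hv' := (Pv * Iv).mul_nonsing_inv (isUnit_iff_ne_zero.mpr hv)
  have hw' := (Pw * Iw).nonsing_inv_mul (isUnit_iff_ne_zero.mpr hw)
  have hw'' := (Pw * Iw).mul_nonsing_inv (isUnit_iff_ne_zero.mpr hw)
  have comm : ∀ (A : Matrix ι κ ℂ) (S : Matrix (Fin p) (Fin q) ℂ), A * Iv = Iw * S →
      Pw * A = S * Pv → S * (Pv * Iv)⁻¹ = (Pw * Iw)⁻¹ * S := by
    intro A S h1 h2
    have h3 : S * (Pv * Iv) = (Pw * Iw) * S := by
      rw [← Matrix.mul_assoc, ← h2, Matrix.mul_assoc, h1, Matrix.mul_assoc]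
    calc S * (Pv * Iv)⁻¹ = (Pw * Iw)⁻¹ * ((Pw * Iw) * S) * (Pv * Iv)⁻¹ := by
          rw [← Matrix.mul_assoc, hw', Matrix.one_mul]
      _ = (Pw * Iw)⁻¹ * S := by
          rw [← h3, Matrix.mul_assoc, Matrix.mul_assoc, hv', Matrix.mul_one]
  refine split_of_retraction z₀ z₁ (Iv := Iv * (Pv * Iv)⁻¹) (Iw := Iw * (Pw * Iw)⁻¹)
    ?_ ?_ hPA hPE ?_ ?_
  · rw [← Matrix.mul_assoc, hAI, Matrix.mul_assoc, comm A S hAI hPA, Matrix.mul_assoc]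
  · rw [← Matrix.mul_assoc, hEI, Matrix.mul_assoc, comm E D hEI hPE, Matrix.mul_assoc]
  · rw [← Matrix.mul_assoc, hv']
  · rw [← Matrix.mul_assoc, hw'']

/-- An upper triangular Toeplitz matrix with nonzero diagonal is invertible. -/
theorem det_toeplitz_ne_zero {q : ℕ} (t : ℕ → ℕ → ℂ)
    (h0 : t 0 0 ≠ 0) (h1 : ∀ i, i + 1 < q → t (i + 1) 0 = 0)
    (h2 : ∀ i j, i + 1 < q → j + 1 < q → t (i + 1) (j + 1) = t i j) :
    (Matrix.of fun i j : Fin q => t i j).det ≠ 0 := by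
  have hdiag : ∀ i, i < q → t i i = t 0 0 := by
    intro i
    induction i with
    | zero => intro _; rfl
    | succ i ih => intro hi; rw [h2 i i hi hi, ih (by omega)]
  have hlow : ∀ j i, i < q → j < i → t i j = 0 := by
    intro j
    induction j with
    | zero =>
      intro i hi hj
      obtain ⟨i, rfl⟩ := Nat.exists_eq_succ_of_ne_zero hj.ne'
      exact h1 i hi
    | succ j ih =>
      intro i hi hj
      obtain ⟨i, rfl⟩ := Nat.exists_eq_succ_of_ne_zero (Nat.ne_zero_of_lt hj)
      rw [Nat.succ_eq_add_one, h2 i j hi (by omega), ih i (by omega) (by omega)]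
  have hT : (Matrix.of fun i j : Fin q => t i j).IsUpperTriangular :=
    fun i j hij => hlow j i i.2 hij
  rw [Matrix.det_of_isUpperTriangular hT]
  exact Finset.prod_ne_zero_iff.mpr fun i _ => by simpa [hdiag i i.2] using h0

/-- The matrix with ones on the diagonal. -/
def diagOnes (p q : ℕ) : Matrix (Fin p) (Fin q) ℂ :=
  Matrix.of fun i j => if (j : ℕ) = i then 1 else 0

/-- The matrix with ones on the superdiagonal. -/
def superOnes (p q : ℕ) : Matrix (Fin p) (Fin q) ℂ :=
  Matrix.of fun i j => if (j : ℕ) = i + 1 then 1 else 0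

/-- A chain `x` and a dual cochain `φ` that meet in their first terms split off a block. -/
theorem split_of_chain {p q : ℕ} (hpq : p ≤ q) (hqp : q ≤ p + 1) (z₀ z₁ : ℂ[X])
    {A E : Matrix ι κ ℂ} (x : ℕ → κ → ℂ) (y : ℕ → ι → ℂ) (φ : ℕ → κ → ℂ) (ψ : ℕ → ι → ℂ)
    (hA0 : A *ᵥ x 0 = 0) (hA : ∀ j, j + 1 < q → A *ᵥ x (j + 1) = y j)
    (hE : ∀ j, j < p → E *ᵥ x j = y j) (hEp : ∀ j, p ≤ j → j < q → E *ᵥ x j = 0)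
    (hψE : ∀ i, i < p → ψ i ᵥ* E = φ i) (hψA : ∀ i, i < p → i + 1 < q → ψ i ᵥ* A = φ (i + 1))
    (hψA' : ∀ i, i < p → q ≤ i + 1 → ψ i ᵥ* A = 0) (h0 : φ 0 ⬝ᵥ x 0 ≠ 0) :
    ∃ (p' q' : ℕ) (A' E' : Matrix (Fin p') (Fin q') ℂ),
      p + p' = Fintype.card ι ∧ q + q' = Fintype.card κ ∧
      ConstEquiv (z₀ • A.map C + z₁ • E.map C)
        (dsum (z₀ • (superOnes p q).map C + z₁ • (diagOnes p q).map C)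
          (z₀ • A'.map C + z₁ • E'.map C)) := by
  -- These identities make the pairings `φ i ⬝ᵥ x j` an upper triangular Toeplitz matrix with
  -- diagonal `φ 0 ⬝ᵥ x 0`. The pairings `ψ i ⬝ᵥ y j` are its leading `p × p` part, so one nonzero
  -- number settles both determinants.
  have hx1 : ∀ i, i < p → i + 1 < q → φ (i + 1) ⬝ᵥ x 0 = 0 := fun i hi hi' => by
    rw [← hψA i hi hi', ← Matrix.dotProduct_mulVec, hA0, dotProduct_zero]
  have hx2 : ∀ i j, i < p → j < p → ψ i ⬝ᵥ y j = φ i ⬝ᵥ x j := fun i j hi hj => by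
    rw [← hE j hj, Matrix.dotProduct_mulVec, hψE i hi]
  have hx3 : ∀ i j, i < p → i + 1 < q → j + 1 < q → φ (i + 1) ⬝ᵥ x (j + 1) = φ i ⬝ᵥ x j :=
    fun i j hi hi' hj => by
      rw [← hψA i hi hi', ← Matrix.dotProduct_mulVec, hA j hj, hx2 i j hi (by omega)]
  refine split_of_isUnit z₀ z₁ (Iv := Matrix.of fun k j => x j k) (Iw := Matrix.of fun k j => y j k)
    (Pv := Matrix.of fun i k => φ i k) (Pw := Matrix.of fun i k => ψ i k) ?_ ?_ ?_ ?_ ?_ ?_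
  · ext i ⟨j, hj⟩
    have : (A * Matrix.of fun k (j : Fin q) => x j k) i ⟨j, hj⟩ = (A *ᵥ x j) i := rfl
    rw [this]
    rcases j with _ | j
    · simp [hA0, Matrix.mul_apply, superOnes]
    · rw [hA j hj]
      have hjp : j < p := by omega
      rw [Matrix.mul_apply, Finset.sum_eq_single ⟨j, hjp⟩]
      · simp [superOnes]
      · intro b _ hb
        have : ¬ j = b := fun h => hb (Fin.ext h.symm)
        simp [superOnes, this]
      · simp
  · ext i ⟨j, hj⟩
    have : (E * Matrix.of fun k (j : Fin q) => x j k) i ⟨j, hj⟩ = (E *ᵥ x j) i := rfl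
    rw [this]
    by_cases hjp : j < p
    · rw [hE j hjp, Matrix.mul_apply, Finset.sum_eq_single ⟨j, hjp⟩]
      · simp [diagOnes]
      · intro b _ hb
        have : ¬ j = b := fun h => hb (Fin.ext h.symm)
        simp [diagOnes, this]
      · simp
    · rw [hEp j (by omega) hj, Matrix.mul_apply, Finset.sum_eq_zero]
      · rfl
      · intro b _
        have : ¬ j = b := fun h => hjp (h ▸ b.2)
        simp [diagOnes, this]
  · ext ⟨i, hi⟩ k
    have : ((Matrix.of fun (i : Fin p) k => ψ i k) * A) ⟨i, hi⟩ k = (ψ i ᵥ* A) k := rfl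
    rw [this]
    by_cases hiq : i + 1 < q
    · rw [hψA i hi hiq, Matrix.mul_apply, Finset.sum_eq_single ⟨i + 1, hiq⟩]
      · simp [superOnes]
      · intro b _ hb
        have : ¬ (b : ℕ) = i + 1 := fun h => hb (Fin.ext h)
        simp [superOnes, this]
      · simp
    · rw [hψA' i hi (by omega), Matrix.mul_apply, Finset.sum_eq_zero]
      · rfl
      · intro b _
        have : ¬ (b : ℕ) = i + 1 := by omega
        simp [superOnes, this]
  · ext ⟨i, hi⟩ k
    have : ((Matrix.of fun (i : Fin p) k => ψ i k) * E) ⟨i, hi⟩ k = (ψ i ᵥ* E) k := rfl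
    rw [this, hψE i hi, Matrix.mul_apply, Finset.sum_eq_single ⟨i, by omega⟩]
    · simp [diagOnes]
    · intro b _ hb
      have : ¬ (b : ℕ) = i := fun h => hb (Fin.ext h)
      simp [diagOnes, this]
    · simp
  · exact det_toeplitz_ne_zero (q := q) (fun i j => φ i ⬝ᵥ x j) h0
      (fun i hi => hx1 i (by omega) hi) (fun i j hi hj => hx3 i j (by omega) hi hj)
  · by_cases hp0 : p = 0
    · subst hp0; simp
    have : ((Matrix.of fun (i : Fin p) k => ψ i k) * Matrix.of fun k (j : Fin p) => y j k) =
        Matrix.of fun i j : Fin p => φ i ⬝ᵥ x j := by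
      ext i j
      exact hx2 i j i.2 j.2
    rw [this]
    exact det_toeplitz_ne_zero (q := p) (fun i j => φ i ⬝ᵥ x j) h0
      (fun i hi => hx1 i (by omega) (by omega))
      (fun i j hi hj => hx3 i j (by omega) (by omega) (by omega))

end Splitting

/-! ### Chains of the linear relation `A E⁻¹` and their duals -/

section Chains

variable {ι κ : Type*} [Fintype ι] [DecidableEq ι] [Fintype κ] [DecidableEq κ]

/-- The image of a subspace under the linear relation `A E⁻¹`. -/
noncomputable def relStep (A E : Matrix ι κ ℂ) (R : Submodule ℂ (ι → ℂ)) :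
    Submodule ℂ (ι → ℂ) :=
  (R.comap E.mulVecLin).map A.mulVecLin

theorem mem_relStep {A E : Matrix ι κ ℂ} {R : Submodule ℂ (ι → ℂ)} {w : ι → ℂ} :
    w ∈ relStep A E R ↔ ∃ x, E *ᵥ x ∈ R ∧ A *ᵥ x = w := by
  simp [relStep]

/-- Membership in the `k`-th iterate means that the chain can be prolonged `k` times. With `R = ⊥`
it then terminates; with `R = ⊤` the end is unconstrained. -/
theorem exists_chain {A E : Matrix ι κ ℂ} {R : Submodule ℂ (ι → ℂ)} (k : ℕ) (v : κ → ℂ)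
    (h : E *ᵥ v ∈ (relStep A E)^[k] R) :
    ∃ x : ℕ → κ → ℂ, x 0 = v ∧ (∀ i < k, A *ᵥ x (i + 1) = E *ᵥ x i) ∧ E *ᵥ x k ∈ R := by
  induction k generalizing v with
  | zero => exact ⟨fun _ => v, rfl, by simp, h⟩
  | succ k ih =>
    rw [Function.iterate_succ_apply', mem_relStep] at h
    obtain ⟨u, hu, hv⟩ := h
    obtain ⟨x, hx0, hx, hxk⟩ := ih u hu
    refine ⟨fun i => Nat.casesOn i v x, rfl, fun i hi => ?_, hxk⟩
    rcases i with _ | i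
    · simpa [hx0] using hv
    · exact hx i (by omega)

/-- The functional `ψ A` vanishes on the kernel of `E` followed by the quotient map modulo `R`, so
it factors through that composite; the factor is `ψ'`. -/
theorem exists_vecMul_eq {A E : Matrix ι κ ℂ} {R : Submodule ℂ (ι → ℂ)} (ψ : ι → ℂ)
    (h : ∀ w ∈ relStep A E R, ψ ⬝ᵥ w = 0) :
    ∃ ψ' : ι → ℂ, ψ ᵥ* A = ψ' ᵥ* E ∧ ∀ w ∈ R, ψ' ⬝ᵥ w = 0 := by
  let T := R.mkQ ∘ₗ E.mulVecLin
  have hg : (dotProductEquiv ℂ ι ψ) ∘ₗ A.mulVecLin ∈ (LinearMap.ker T).dualAnnihilator := by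
    rw [Submodule.mem_dualAnnihilator]
    intro x hx
    have hx' : E *ᵥ x ∈ R := by simpa [T] using hx
    exact h _ (mem_relStep.mpr ⟨x, hx', rfl⟩)
  rw [← LinearMap.range_dualMap_eq_dualAnnihilator_ker] at hg
  obtain ⟨g, hg⟩ := hg
  have hg' : ∀ w, (dotProductEquiv ℂ ι).symm (g ∘ₗ R.mkQ) ⬝ᵥ w = g (R.mkQ w) := fun w =>
    LinearMap.congr_fun ((dotProductEquiv ℂ ι).apply_symm_apply (g ∘ₗ R.mkQ)) w
  refine ⟨(dotProductEquiv ℂ ι).symm (g ∘ₗ R.mkQ), ?_, fun w hw => ?_⟩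
  · refine dotProduct_eq _ _ fun x => ?_
    rw [← Matrix.dotProduct_mulVec, ← Matrix.dotProduct_mulVec, hg']
    exact (LinearMap.congr_fun hg x).symm
  · rw [hg', (Submodule.Quotient.mk_eq_zero R).mpr hw |> fun h => (h : R.mkQ w = 0), map_zero]

theorem exists_cochain {A E : Matrix ι κ ℂ} {R : Submodule ℂ (ι → ℂ)} (k : ℕ) (ψ₀ : ι → ℂ)
    (h : ∀ w ∈ (relStep A E)^[k] R, ψ₀ ⬝ᵥ w = 0) :
    ∃ ψ : ℕ → ι → ℂ, ψ 0 = ψ₀ ∧ (∀ i < k, ψ i ᵥ* A = ψ (i + 1) ᵥ* E) ∧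
      ∀ w ∈ R, ψ k ⬝ᵥ w = 0 := by
  induction k generalizing ψ₀ with
  | zero => exact ⟨fun _ => ψ₀, rfl, by simp, h⟩
  | succ k ih =>
    rw [Function.iterate_succ_apply'] at h
    obtain ⟨ψ₁, h1, h2⟩ := exists_vecMul_eq ψ₀ h
    obtain ⟨ψ, hψ0, hψ, hψk⟩ := ih ψ₁ h2
    refine ⟨fun i => Nat.casesOn i ψ₀ ψ, rfl, fun i hi => ?_, hψk⟩
    rcases i with _ | i
    · simpa [hψ0] using h1
    · exact hψ i (by omega)

/-- The obstruction to prolonging a chain is witnessed dually: a functional separating `w` from the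
iterate starts a cochain. -/
theorem exists_cochain_of_notMem {A E : Matrix ι κ ℂ} {R : Submodule ℂ (ι → ℂ)} (k : ℕ)
    {w : ι → ℂ} (h : w ∉ (relStep A E)^[k] R) :
    ∃ ψ : ℕ → ι → ℂ, ψ 0 ⬝ᵥ w ≠ 0 ∧ (∀ i < k, ψ i ᵥ* A = ψ (i + 1) ᵥ* E) ∧
      ∀ w ∈ R, ψ k ⬝ᵥ w = 0 := by
  obtain ⟨f, hf, hf'⟩ := Submodule.exists_le_ker_of_notMem h
  have hd : ∀ w, (dotProductEquiv ℂ ι).symm f ⬝ᵥ w = f w := fun w =>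
    LinearMap.congr_fun ((dotProductEquiv ℂ ι).apply_symm_apply f) w
  obtain ⟨ψ, h0, h1, h2⟩ := exists_cochain (A := A) (E := E) (R := R) k
    ((dotProductEquiv ℂ ι).symm f) fun w hw => by rw [hd]; exact hf' hw
  exact ⟨ψ, by rwa [h0, hd], h1, h2⟩

/-- A finite chain starting in the kernel of `A` splits off a right Kronecker block. -/
theorem split_right (z₀ z₁ : ℂ[X]) {A E : Matrix ι κ ℂ} {v : κ → ℂ} (hv : v ≠ 0)
    (hA : A *ᵥ v = 0) (hE : ∃ k, E *ᵥ v ∈ (relStep A E)^[k] ⊥) :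
    ∃ (ε p' q' : ℕ) (A' E' : Matrix (Fin p') (Fin q') ℂ),
      ε + p' = Fintype.card ι ∧ ε + 1 + q' = Fintype.card κ ∧
      ConstEquiv (z₀ • A.map C + z₁ • E.map C)
        (dsum (z₀ • (superOnes ε (ε + 1)).map C + z₁ • (diagOnes ε (ε + 1)).map C)
          (z₀ • A'.map C + z₁ • E'.map C)) := by
  classical
  have hmem := Nat.find_spec hE
  have hmin := fun m => Nat.find_min hE (m := m)
  obtain ⟨k, hk⟩ : ∃ k, k = Nat.find hE := ⟨_, rfl⟩
  rw [← hk] at hmem hmin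
  refine ⟨k, ?_⟩
  obtain ⟨x, hx0, hx, hxk⟩ := exists_chain k v hmem
  rcases k with _ | k
  -- Here `v` lies in both kernels and spans a zero column `L₀`; a coordinate functional with `v i ≠
  -- 0` serves as `φ 0`.
  · obtain ⟨i, hi⟩ := Function.ne_iff.mp hv
    refine split_of_chain (by omega) (by omega) z₀ z₁ x (fun _ => 0) (fun _ => Pi.single i 1)
      (fun _ => 0) (by rwa [hx0]) (by omega) (by omega) ?_ (by omega) (by omega) (by omega) ?_
    · intro j _ hj
      obtain rfl : j = 0 := by omega
      exact hxk
    · simpa [hx0] using hi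
  -- The chain has length `k + 2`, and minimality supplies a cochain `ψ 0, …, ψ k`, one functional
  -- for each of the `k + 1` rows. The additional column functional is `ψ k ᵥ* A`.
  · obtain ⟨ψ, h0, h1, -⟩ := exists_cochain_of_notMem k (hmin k (by omega))
    refine split_of_chain (by omega) (by omega) z₀ z₁ x (fun j => E *ᵥ x j)
      (fun i => if i ≤ k then ψ i ᵥ* E else ψ k ᵥ* A) ψ (by rwa [hx0])
      (fun j hj => hx j (by omega)) (fun _ _ => rfl) ?_ ?_ ?_ (by omega) ?_
    · intro j hj hj'
      obtain rfl : j = k + 1 := by omega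
      exact hxk
    · intro i hi
      rw [if_pos (by omega)]
    · intro i hi _
      split_ifs with h
      · exact h1 i (by omega)
      · rw [show i = k by omega]
    · simpa [← Matrix.dotProduct_mulVec, hx0] using h0

/-- A chain starting in the kernel of `A` that cannot be prolonged indefinitely splits off a
Jordan block. -/
theorem split_square (z₀ z₁ : ℂ[X]) {A E : Matrix ι κ ℂ} {v : κ → ℂ}
    (hA : A *ᵥ v = 0) (hE : ∃ k, E *ᵥ v ∉ (relStep A E)^[k] ⊤) :
    ∃ (k p' q' : ℕ) (A' E' : Matrix (Fin p') (Fin q') ℂ),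
      0 < k ∧ k + p' = Fintype.card ι ∧ k + q' = Fintype.card κ ∧
      ConstEquiv (z₀ • A.map C + z₁ • E.map C)
        (dsum (z₀ • (superOnes k k).map C + z₁ • (diagOnes k k).map C)
          (z₀ • A'.map C + z₁ • E'.map C)) := by
  classical
  have hmem := Nat.find_spec hE
  have hmin := fun m => Nat.find_min hE (m := m)
  obtain ⟨k, hk⟩ : ∃ k, k = Nat.find hE := ⟨_, rfl⟩
  rw [← hk] at hmem hmin
  rcases k with _ | k
  · exact absurd Submodule.mem_top hmem
  obtain ⟨x, hx0, hx, -⟩ := exists_chain k v (not_not.mp (hmin k (by omega)))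
  obtain ⟨ψ, h0, h1, h2⟩ := exists_cochain_of_notMem _ hmem
  -- A functional annihilating everything is zero, so `ψ k ᵥ* A = 0`: the cochain stops without an
  -- extra column and the block is square.
  have hψ : ψ (k + 1) = 0 := dotProduct_eq_zero _ fun w => h2 w Submodule.mem_top
  obtain ⟨p', q', A', E', hp, hq, h⟩ := split_of_chain (p := k + 1) (q := k + 1) le_rfl (by omega)
    z₀ z₁ (A := A) (E := E) x (fun j => E *ᵥ x j) (fun i => ψ i ᵥ* E) ψ (by rwa [hx0])
    (fun j hj => hx j (by omega)) (fun _ _ => rfl) (by omega) (fun _ _ => rfl)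
    (fun i hi _ => h1 i hi)
    (fun i hi hi' => by
      rw [h1 i hi, show i = k by omega, hψ, Matrix.zero_vecMul])
    (by simpa [← Matrix.dotProduct_mulVec, hx0] using h0)
  exact ⟨k + 1, p', q', A', E', by omega, hp, hq, h⟩

theorem relStep_mono (A E : Matrix ι κ ℂ) : Monotone (relStep A E) := fun _ _ h =>
  Submodule.map_mono (Submodule.comap_mono h)

/-- In a regular pencil no chain starting in the kernel can be prolonged indefinitely. -/
theorem exists_notMem_relStep {A E : Matrix ι κ ℂ} {a e : ℂ}
    (hreg : ∀ x, (a • A + e • E) *ᵥ x = 0 → x = 0) {v : κ → ℂ} (hv : v ≠ 0) (hA : A *ᵥ v = 0) :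
    ∃ k, E *ᵥ v ∉ (relStep A E)^[k] ⊤ := by
  by_contra! hmem
  have hanti : Antitone fun n => (relStep A E)^[n] ⊤ :=
    (relStep_mono A E).antitone_iterate_of_map_le le_top
  obtain ⟨n, hn⟩ := IsArtinian.monotone_stabilizes
    (⟨fun n => OrderDual.toDual ((relStep A E)^[n] ⊤), fun _ _ h => hanti h⟩ :
      ℕ →o (Submodule ℂ (ι → ℂ))ᵒᵈ)
  -- On the stable `R`, the map `A` sends `U = E⁻¹ R` onto `R`, while `a • A + e • E` embeds `U` in
  -- `R`. Equal dimensions make `A` injective on `U`, which contains the kernel vector `v`.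
  set R := (relStep A E)^[n] ⊤ with hR
  have hstab : relStep A E R = R := by
    have := hn (n + 1) (by omega)
    have h' : R = (relStep A E)^[n + 1] ⊤ := this
    rw [Function.iterate_succ_apply'] at h'
    exact h'.symm
  let U := R.comap E.mulVecLin
  have hAU : ∀ x ∈ U, A *ᵥ x ∈ R := fun x hx => hstab ▸ mem_relStep.mpr ⟨x, hx, rfl⟩
  let f : U →ₗ[ℂ] R := A.mulVecLin.restrict hAU
  let g : U →ₗ[ℂ] R := (a • A + e • E).mulVecLin.restrict fun x hx => by
    have hx' : E *ᵥ x ∈ R := hx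
    simpa [Matrix.add_mulVec, Matrix.smul_mulVec] using
      R.add_mem (R.smul_mem a (hAU x hx)) (R.smul_mem e hx')
  have hg : Function.Injective g := (injective_iff_map_eq_zero g).mpr fun x hx =>
    Subtype.ext (hreg x (congrArg Subtype.val hx))
  have hf : Function.Surjective f := fun ⟨w, hw⟩ => by
    rw [← hstab, mem_relStep] at hw
    obtain ⟨x, hx, rfl⟩ := hw
    exact ⟨⟨x, hx⟩, rfl⟩
  have hdim : Module.finrank ℂ U = Module.finrank ℂ R :=
    le_antisymm (LinearMap.finrank_le_finrank_of_injective hg)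
      (LinearMap.finrank_le_finrank_of_surjective hf)
  have hfi := (LinearMap.injective_iff_surjective_of_finrank_eq_finrank hdim).mpr hf
  have hvU : v ∈ U := hmem n
  have : (⟨v, hvU⟩ : U) = 0 := hfi (by rw [map_zero]; exact Subtype.ext hA)
  exact hv (congrArg Subtype.val this)

end Chains

/-! ### Existence of the Kronecker canonical form -/

section CanonicalForm

variable {ι κ ι' κ' : Type*} [Fintype ι] [DecidableEq ι] [Fintype κ] [DecidableEq κ]
  [Fintype ι'] [DecidableEq ι'] [Fintype κ'] [DecidableEq κ']

/-- A polynomial matrix that is strictly equivalent to a Kronecker canonical form. -/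
def HasKroneckerForm (M : Matrix ι κ ℂ[X]) : Prop :=
  ∃ (a f g b : ℕ) (ε : Fin a → ℕ) (α : Fin f → ℂ) (k : Fin f → ℕ) (l : Fin g → ℕ)
    (η : Fin b → ℕ), (∀ i, 0 < k i) ∧ (∀ i, 0 < l i) ∧
    ConstEquiv M (dsum (dsum (rightPart ε) (finitePart α k)) (dsum (infinitePart l) (leftPart η)))

theorem HasKroneckerForm.of_constEquiv {M : Matrix ι κ ℂ[X]} {N : Matrix ι' κ' ℂ[X]}
    (h : ConstEquiv M N) (hN : HasKroneckerForm N) : HasKroneckerForm M := by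
  obtain ⟨a, f, g, b, ε, α, k, l, η, hk, hl, hN⟩ := hN
  exact ⟨a, f, g, b, ε, α, k, l, η, hk, hl, h.trans hN⟩

theorem HasKroneckerForm.dsum {M : Matrix ι κ ℂ[X]} {N : Matrix ι' κ' ℂ[X]}
    (hM : HasKroneckerForm M) (hN : HasKroneckerForm N) : HasKroneckerForm (dsum M N) := by
  obtain ⟨a, f, g, b, ε, α, k, l, η, hk, hl, hM⟩ := hM
  obtain ⟨a', f', g', b', ε', α', k', l', η', hk', hl', hN⟩ := hN
  obtain ⟨z₁, -, h₁⟩ := dsum_blockDiagonal' rightBlock ε ε'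
  obtain ⟨z₂, hz₂, h₂⟩ := dsum_blockDiagonal' (T := ℂ × ℕ) (r := Prod.snd) (c := Prod.snd)
    (fun t => finiteBlock t.1 t.2) (fun i => (α i, k i)) (fun i => (α' i, k' i))
  obtain ⟨z₃, hz₃, h₃⟩ := dsum_blockDiagonal' (r := id) (c := id) infiniteBlock l l'
  obtain ⟨z₄, -, h₄⟩ := dsum_blockDiagonal' (r := fun t => t + 1) (c := id) leftBlock η η'
  refine ⟨_, _, _, _, z₁, fun i => (z₂ i).1, fun i => (z₂ i).2, z₃, z₄,
    hz₂ (fun t => 0 < t.2) hk hk', hz₃ (fun t => 0 < t) hl hl', ?_⟩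
  exact (hM.dsum_congr hN).trans <| (dsum_dsum_comm _ _ _ _).trans <|
    ((dsum_dsum_comm _ _ _ _).trans (h₁.dsum_congr h₂)).dsum_congr
      ((dsum_dsum_comm _ _ _ _).trans (h₃.dsum_congr h₄))

theorem constEquiv_dsum_empty [IsEmpty ι'] [IsEmpty κ'] (M : Matrix ι κ ℂ[X])
    (N : Matrix ι' κ' ℂ[X]) : ConstEquiv M (dsum M N) := by
  convert ConstEquiv.of_reindex M (Equiv.sumEmpty ι ι') (Equiv.sumEmpty κ κ') using 1
  ext i j
  rcases i with i | i
  · rcases j with j | j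
    · simp [dsum]
    · exact isEmptyElim j
  · exact isEmptyElim i

theorem constEquiv_empty_dsum [IsEmpty ι'] [IsEmpty κ'] (M : Matrix ι κ ℂ[X])
    (N : Matrix ι' κ' ℂ[X]) : ConstEquiv M (dsum N M) := by
  convert ConstEquiv.of_reindex M (Equiv.emptySum ι' ι) (Equiv.emptySum κ' κ) using 1
  ext i j
  rcases i with i | i
  · exact isEmptyElim i
  · rcases j with j | j
    · exact isEmptyElim j
    · simp [dsum]

theorem constEquiv_blockDiagonal'_single {T : Type*} {r c : T → ℕ}
    (F : ∀ t, Matrix (Fin (r t)) (Fin (c t)) ℂ[X]) (t : T) :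
    ConstEquiv (F t) (blockDiagonal' fun _ : Fin 1 => F t) := by
  convert ConstEquiv.of_reindex (F t) (Equiv.uniqueSigma fun _ : Fin 1 => Fin (r t))
    (Equiv.uniqueSigma fun _ : Fin 1 => Fin (c t)) using 1
  refine Matrix.ext fun ⟨i, j⟩ ⟨i', j'⟩ => ?_
  obtain rfl := Subsingleton.elim i i'
  rw [blockDiagonal'_apply_eq]
  obtain rfl := Subsingleton.elim i 0
  rfl

theorem hasKroneckerForm_rightBlock (ε : ℕ) : HasKroneckerForm (rightBlock ε) :=
  ⟨1, 0, 0, 0, fun _ => ε, Fin.elim0, Fin.elim0, Fin.elim0, Fin.elim0, fun i => i.elim0,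
    fun i => i.elim0, ((constEquiv_blockDiagonal'_single rightBlock ε).trans
      (constEquiv_dsum_empty _ _)).trans (constEquiv_dsum_empty _ _)⟩

theorem hasKroneckerForm_finiteBlock (α : ℂ) {k : ℕ} (hk : 0 < k) :
    HasKroneckerForm (finiteBlock α k) :=
  ⟨0, 1, 0, 0, Fin.elim0, fun _ => α, fun _ => k, Fin.elim0, Fin.elim0, fun _ => hk,
    fun i => i.elim0, ((constEquiv_blockDiagonal'_single (T := ℂ × ℕ) (r := Prod.snd)
      (c := Prod.snd) (fun t => finiteBlock t.1 t.2) (α, k)).trans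
      (constEquiv_empty_dsum _ _)).trans (constEquiv_dsum_empty _ _)⟩

theorem hasKroneckerForm_infiniteBlock {l : ℕ} (hl : 0 < l) :
    HasKroneckerForm (infiniteBlock l) :=
  ⟨0, 0, 1, 0, Fin.elim0, Fin.elim0, Fin.elim0, fun _ => l, Fin.elim0, fun i => i.elim0,
    fun _ => hl, ((constEquiv_blockDiagonal'_single (r := id) (c := id) infiniteBlock l).trans
      (constEquiv_dsum_empty _ _)).trans (constEquiv_empty_dsum _ _)⟩

theorem hasKroneckerForm_leftBlock (η : ℕ) : HasKroneckerForm (leftBlock η) :=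
  ⟨0, 0, 0, 1, Fin.elim0, Fin.elim0, Fin.elim0, Fin.elim0, fun _ => η, fun i => i.elim0,
    fun i => i.elim0, ((constEquiv_blockDiagonal'_single (r := fun t => t + 1) (c := id)
      leftBlock η).trans (constEquiv_empty_dsum _ _)).trans (constEquiv_empty_dsum _ _)⟩

theorem constEquiv_of_isEmpty [IsEmpty ι] [IsEmpty κ] [IsEmpty ι'] [IsEmpty κ']
    (M : Matrix ι κ ℂ[X]) (N : Matrix ι' κ' ℂ[X]) : ConstEquiv M N :=
  ⟨0, 0, 0, 0, Subsingleton.elim _ _, Subsingleton.elim _ _, Subsingleton.elim _ _,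
    Subsingleton.elim _ _, Subsingleton.elim _ _⟩

theorem hasKroneckerForm_of_isEmpty [IsEmpty ι] [IsEmpty κ] (M : Matrix ι κ ℂ[X]) :
    HasKroneckerForm M :=
  ⟨0, 0, 0, 0, Fin.elim0, Fin.elim0, Fin.elim0, Fin.elim0, Fin.elim0, fun i => i.elim0,
    fun i => i.elim0, constEquiv_of_isEmpty _ _⟩

/-- Right, finite and infinite blocks are one band matrix, with super- and main diagonal entries
`(1, λ)`, `(1, α - λ)` and `(-λ, 1)`. One splitting lemma with parameters `z₀`, `z₁` therefore
serves all three. -/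
theorem rightBlock_eq (ε : ℕ) : rightBlock ε =
    (1 : ℂ[X]) • (superOnes ε (ε + 1)).map C + (X : ℂ[X]) • (diagOnes ε (ε + 1)).map C := by
  refine Matrix.ext fun i j => ?_
  simp only [rightBlock, superOnes, diagOnes, Matrix.of_apply, Matrix.add_apply,
    Matrix.smul_apply, Matrix.map_apply, Fin.ext_iff, Fin.val_castSucc, Fin.val_succ, smul_eq_mul]
  split_ifs <;> first | omega | simp

theorem finiteBlock_eq (α : ℂ) (k : ℕ) : finiteBlock α k =
    (1 : ℂ[X]) • (superOnes k k).map C + (C α - X : ℂ[X]) • (diagOnes k k).map C := by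
  refine Matrix.ext fun i j => ?_
  simp only [finiteBlock, superOnes, diagOnes, Matrix.of_apply, Matrix.add_apply,
    Matrix.smul_apply, Matrix.map_apply, Fin.ext_iff, smul_eq_mul]
  split_ifs <;> first | omega | simp

theorem infiniteBlock_eq (k : ℕ) : infiniteBlock k =
    (-X : ℂ[X]) • (superOnes k k).map C + (1 : ℂ[X]) • (diagOnes k k).map C := by
  refine Matrix.ext fun i j => ?_
  simp only [infiniteBlock, superOnes, diagOnes, Matrix.of_apply, Matrix.add_apply,
    Matrix.smul_apply, Matrix.map_apply, Fin.ext_iff, smul_eq_mul]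
  split_ifs <;> first | omega | simp

theorem smul_add_X_smul_eq_pencil (A E : Matrix ι κ ℂ) :
    (1 : ℂ[X]) • A.map C + (X : ℂ[X]) • E.map C = pencil A (-E) := by
  refine Matrix.ext fun i j => ?_
  simp [pencil]

theorem smul_add_sub_smul_eq_pencil (α : ℂ) (A E : Matrix ι κ ℂ) :
    (1 : ℂ[X]) • A.map C + (C α - X : ℂ[X]) • E.map C = pencil (A + α • E) E := by
  refine Matrix.ext fun i j => ?_
  simp [pencil]
  ring

theorem neg_smul_add_smul_eq_pencil (A E : Matrix ι κ ℂ) :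
    (-X : ℂ[X]) • E.map C + (1 : ℂ[X]) • A.map C = pencil A E := by
  refine Matrix.ext fun i j => ?_
  simp [pencil]
  ring

theorem pencil_transpose (A E : Matrix ι κ ℂ) : (pencil A E)ᵀ = pencil Aᵀ Eᵀ := by
  refine Matrix.ext fun i j => ?_
  simp [pencil]

theorem coeff_map_C_mulVec (A : Matrix ι κ ℂ) (u : κ → ℂ[X]) (n : ℕ) (i : ι) :
    ((A.map C *ᵥ u) i).coeff n = (A *ᵥ fun j => (u j).coeff n) i := by
  simp [Matrix.mulVec, dotProduct]

/-- A nonzero polynomial null vector of a pencil yields a finite chain. -/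
theorem exists_chain_of_mulVec_eq_zero {A E : Matrix ι κ ℂ} {u : κ → ℂ[X]} (hu : u ≠ 0)
    (h : pencil A E *ᵥ u = 0) :
    ∃ v : κ → ℂ, v ≠ 0 ∧ A *ᵥ v = 0 ∧ ∃ k, (-E) *ᵥ v ∈ (relStep A (-E))^[k] ⊥ := by
  classical
  let v : ℕ → κ → ℂ := fun n j => (u j).coeff n
  have hcoeff : ∀ n i, (A *ᵥ v n) i = (X * (E.map C *ᵥ u) i).coeff n := by
    intro n i
    have := congrArg (fun p => p.coeff n) (congrFun h i)
    simp only [pencil, Matrix.sub_mulVec, Matrix.smul_mulVec, Pi.sub_apply, Pi.smul_apply,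
      smul_eq_mul, Polynomial.coeff_sub, Pi.zero_apply, Polynomial.coeff_zero] at this
    rw [← coeff_map_C_mulVec]
    exact sub_eq_zero.mp this
  have h0 : A *ᵥ v 0 = 0 := by
    funext i
    rw [hcoeff]; simp
  have hs : ∀ n, A *ᵥ v (n + 1) = E *ᵥ v n := by
    intro n
    funext i
    rw [hcoeff, Polynomial.coeff_X_mul, coeff_map_C_mulVec]
  have hex : ∃ n, v n ≠ 0 := by
    obtain ⟨j, hj⟩ := Function.ne_iff.mp hu
    obtain ⟨n, hn⟩ : ∃ n, (u j).coeff n ≠ 0 := by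
      by_contra! hc
      exact hj (Polynomial.ext hc)
    exact ⟨n, fun hv => hn (congrFun hv j)⟩
  obtain ⟨N, hN⟩ : ∃ N, ∀ n, N ≤ n → v n = 0 := by
    refine ⟨Finset.univ.sup (fun j => (u j).natDegree) + 1, fun n hn => ?_⟩
    funext j
    refine Polynomial.coeff_eq_zero_of_natDegree_lt ?_
    have := Finset.le_sup (f := fun j => (u j).natDegree) (Finset.mem_univ j)
    omega
  -- The lowest nonzero coefficient starts the chain: the coefficient below it is zero, so `A` kills
  -- it.
  obtain ⟨m, hm⟩ : ∃ m, m = Nat.find hex := ⟨_, rfl⟩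
  have hspec := Nat.find_spec hex
  rw [← hm] at hspec
  have hAm : A *ᵥ v m = 0 := by
    rcases m with _ | m
    · exact h0
    · rw [hs, not_not.mp (Nat.find_min hex (show m < Nat.find hex by omega)), Matrix.mulVec_zero]
  -- The scalar `c` absorbs the alternating signs caused by `-E`; the bound says that `k`
  -- prolongations bring the chain to its last possibly nonzero coefficient.
  have hmem : ∀ k n (c : ℂ), N ≤ n + k + 1 → (-E) *ᵥ (c • v n) ∈ (relStep A (-E))^[k] ⊥ := by
    intro k
    induction k with
    | zero =>
      intro n c hn
      rw [Function.iterate_zero, id, Submodule.mem_bot, Matrix.mulVec_smul, Matrix.neg_mulVec,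
        ← hs, hN (n + 1) (by omega)]
      simp
    | succ k ih =>
      intro n c hn
      rw [Function.iterate_succ_apply', mem_relStep]
      refine ⟨(-c) • v (n + 1), ih _ _ (by omega), ?_⟩
      rw [Matrix.mulVec_smul, hs, Matrix.mulVec_smul, Matrix.neg_mulVec]
      simp
  exact ⟨v m, hspec, hAm, N, by simpa using hmem N m 1 (by omega)⟩

/-- A pencil without polynomial null vectors on either side is regular. -/
theorem regular_of_no_null_vectors {A E : Matrix ι κ ℂ}
    (hr : ∀ u, pencil A E *ᵥ u = 0 → u = 0) (hl : ∀ u, (pencil A E)ᵀ *ᵥ u = 0 → u = 0) :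
    ∃ (e : ι ≃ κ) (c : ℂ), ((A - c • E).submatrix id e).det ≠ 0 := by
  have h1 : Fintype.card κ ≤ Fintype.card ι := card_le_of_injective ℂ[X] (pencil A E).mulVecLin
    ((injective_iff_map_eq_zero _).mpr hr)
  have h2 : Fintype.card ι ≤ Fintype.card κ := card_le_of_injective ℂ[X] (pencil A E)ᵀ.mulVecLin
    ((injective_iff_map_eq_zero _).mpr hl)
  obtain ⟨e⟩ := Fintype.card_eq.mp (le_antisymm h2 h1)
  have hdet : ((pencil A E).submatrix id e).det ≠ 0 := by
    rw [Ne, ← Matrix.exists_mulVec_eq_zero_iff]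
    rintro ⟨x, hx, hx0⟩
    have h3 : pencil A E *ᵥ (x ∘ e.symm) = 0 := by
      have := Matrix.submatrix_mulVec_equiv (pencil A E) x id e
      rw [hx0] at this
      exact this.symm
    refine hx (funext fun i => ?_)
    simpa using congrFun (hr _ h3) (e i)
  -- A polynomial vanishing at every point of the infinite field `ℂ` is zero.
  obtain ⟨c, hc⟩ : ∃ c, (((pencil A E).submatrix id e).det).eval c ≠ 0 := by
    by_contra! hc
    exact hdet (Polynomial.funext fun c => by simpa using hc c)
  refine ⟨e, c, ?_⟩
  rw [← Polynomial.coe_evalRingHom, RingHom.map_det] at hc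
  convert hc using 2
  refine Matrix.ext fun i j => ?_
  simp [pencil]
  exact mul_comm _ _

end CanonicalForm

/-- Every matrix pencil has a Kronecker canonical form. -/
theorem hasKroneckerForm_pencil (N : ℕ) : ∀ {ι κ : Type} [Fintype ι] [DecidableEq ι] [Fintype κ]
    [DecidableEq κ] (A E : Matrix ι κ ℂ), Fintype.card ι + Fintype.card κ = N →
    HasKroneckerForm (pencil A E) := by
  induction N using Nat.strong_induction_on with
  | _ N ih =>
  intro ι κ _ _ _ _ A E hN
  by_cases hr : ∃ u, u ≠ 0 ∧ pencil A E *ᵥ u = 0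
  · obtain ⟨u, hu, hu0⟩ := hr
    obtain ⟨v, hv, hA, hE⟩ := exists_chain_of_mulVec_eq_zero hu hu0
    obtain ⟨ε, p', q', A', E', hp, hq, h⟩ := split_right 1 X hv hA hE
    rw [smul_add_X_smul_eq_pencil, neg_neg, ← rightBlock_eq, smul_add_X_smul_eq_pencil] at h
    exact ((hasKroneckerForm_rightBlock ε).dsum
      (ih (p' + q') (by omega) A' (-E') (by simp))).of_constEquiv h
  by_cases hl : ∃ u, u ≠ 0 ∧ (pencil A E)ᵀ *ᵥ u = 0
  · obtain ⟨u, hu, hu0⟩ := hl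
    rw [pencil_transpose] at hu0
    obtain ⟨v, hv, hA, hE⟩ := exists_chain_of_mulVec_eq_zero hu hu0
    obtain ⟨η, p', q', A', E', hp, hq, h⟩ := split_right 1 X hv hA hE
    rw [smul_add_X_smul_eq_pencil, neg_neg, ← rightBlock_eq, smul_add_X_smul_eq_pencil] at h
    have h' := h.transpose
    rw [← pencil_transpose, Matrix.transpose_transpose, dsum, fromBlocks_transpose,
      Matrix.transpose_zero, Matrix.transpose_zero, pencil_transpose] at h'
    exact ((hasKroneckerForm_leftBlock η).dsum
      (ih (q' + p') (by omega) A'ᵀ (-E')ᵀ (by simp))).of_constEquiv h'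
  push Not at hr hl
  obtain ⟨e, c, hdet⟩ := regular_of_no_null_vectors (A := A) (E := E)
    (fun u hu => by_contra fun h => hr u h hu) (fun u hu => by_contra fun h => hl u h hu)
  have hreg : ∀ x, (A - c • E) *ᵥ x = 0 → x = 0 := by
    intro x hx
    have := Matrix.submatrix_mulVec_equiv (A - c • E) (x ∘ e) id e
    rw [show (x ∘ e) ∘ e.symm = x by ext; simp, hx] at this
    by_contra hne
    refine hdet (Matrix.exists_mulVec_eq_zero_iff.mp ⟨x ∘ e, fun h => hne (funext fun j => ?_), this⟩)
    simpa using congrFun h (e.symm j)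
  cases isEmpty_or_nonempty ι with
  | inl hι =>
    have : IsEmpty κ := e.symm.isEmpty
    exact hasKroneckerForm_of_isEmpty _
  | inr hι =>
    -- An eigenvector of `(A - c E)⁻¹ E` satisfies `E x = μ (A - c E) x`. If `μ = 0` it belongs to
    -- the zero at infinity, otherwise to the finite zero `c + μ⁻¹`.
    obtain ⟨μ, hμ⟩ := Module.End.exists_eigenvalue
      (((A - c • E).submatrix id e)⁻¹ * E.submatrix id e).mulVecLin
    obtain ⟨x, hx⟩ := hμ.exists_hasEigenvector
    have hx1 : E *ᵥ (x ∘ e.symm) = μ • ((A - c • E) *ᵥ (x ∘ e.symm)) := by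
      have h1 := hx.apply_eq_smul
      rw [Matrix.mulVecLin_apply] at h1
      have h2 := congrArg (fun y => ((A - c • E).submatrix id e) *ᵥ y) h1
      simp only [Matrix.mulVec_mulVec, ← Matrix.mul_assoc, Matrix.mulVec_smul] at h2
      rw [Matrix.mul_nonsing_inv _ (isUnit_iff_ne_zero.mpr hdet), Matrix.one_mul,
        Matrix.submatrix_mulVec_equiv, Matrix.submatrix_mulVec_equiv] at h2
      exact h2
    have hx2 : x ∘ e.symm ≠ 0 := fun h => hx.2 (funext fun i => by
      simpa using congrFun h (e i))
    by_cases hμ0 : μ = 0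
    · have hE0 : E *ᵥ (x ∘ e.symm) = 0 := by rw [hx1, hμ0, zero_smul]
      -- The roles of `A` and `E` are exchanged: the chain starts in the kernel of `E`.
      obtain ⟨k, p', q', A', E', hk, hp, hq, h⟩ := split_square (-X) 1 hE0
        (exists_notMem_relStep (A := E) (E := A) (a := -c) (e := 1) (fun x hx => hreg x (by
          rw [← hx]; congr 1; simp [sub_eq_add_neg, add_comm])) hx2 hE0)
      rw [← infiniteBlock_eq, neg_smul_add_smul_eq_pencil, neg_smul_add_smul_eq_pencil] at h
      exact ((hasKroneckerForm_infiniteBlock hk).dsum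
        (ih (p' + q') (by omega) E' A' (by simp))).of_constEquiv h
    · have hA0 : (A - (c + μ⁻¹) • E) *ᵥ (x ∘ e.symm) = 0 := by
        have : A - (c + μ⁻¹) • E = (A - c • E) - μ⁻¹ • E := by rw [add_smul]; abel
        rw [this, Matrix.sub_mulVec, Matrix.smul_mulVec, hx1, inv_smul_smul₀ hμ0, sub_self]
      -- With `α = c + μ⁻¹` the pencil reads `(A - α E) + (α - λ) E`, and `(A - α E) + μ⁻¹ E = A - c
      -- E` witnesses regularity.
      obtain ⟨k, p', q', A', E', hk, hp, hq, h⟩ := split_square 1 (C (c + μ⁻¹) - X) hA0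
        (exists_notMem_relStep (E := E) (a := 1) (e := μ⁻¹) (fun x hx => hreg x (by
          rw [← hx]; congr 1; rw [add_smul, one_smul]; abel)) hx2 hA0)
      rw [← finiteBlock_eq, smul_add_sub_smul_eq_pencil, smul_add_sub_smul_eq_pencil,
        sub_add_cancel] at h
      exact ((hasKroneckerForm_finiteBlock _ hk).dsum
        (ih (p' + q') (by omega) _ E' (by simp))).of_constEquiv h

/-! ### Null vectors of the canonical blocks over a domain receiving `ℂ[X]` -/

section Kernel

variable {ι κ ι' κ' : Type*} [Fintype ι] [DecidableEq ι] [Fintype κ] [DecidableEq κ]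
  [Fintype ι'] [DecidableEq ι'] [Fintype κ'] [DecidableEq κ']

variable {R : Type*} [CommRing R] [IsDomain R] (φ : ℂ[X] →+* R)

/-- A finite vector extended by zero. -/
def extendZero {q : ℕ} (w : Fin q → R) (j : ℕ) : R := if h : j < q then w ⟨j, h⟩ else 0

theorem extendZero_val {q : ℕ} (w : Fin q → R) (j : Fin q) : extendZero w j = w j := by
  simp [extendZero]

theorem extendZero_of_le {q : ℕ} (w : Fin q → R) {j : ℕ} (h : q ≤ j) : extendZero w j = 0 := by
  simp [extendZero, h]

theorem sum_ite_val_eq {q : ℕ} (w : Fin q → R) (n : ℕ) :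
    ∑ j : Fin q, (if (j : ℕ) = n then w j else 0) = extendZero w n := by
  unfold extendZero
  split_ifs with h
  · rw [Finset.sum_eq_single ⟨n, h⟩]
    · simp
    · intro b _ hb
      exact if_neg fun h => hb (Fin.ext h)
    · simp
  · exact Finset.sum_eq_zero fun j _ => if_neg (by omega)

theorem band_mulVec {p q : ℕ} (z₀ z₁ : ℂ[X]) (w : Fin q → R) (i : Fin p) :
    ((z₀ • (superOnes p q).map C + z₁ • (diagOnes p q).map C).map φ *ᵥ w) i =
      φ z₀ * extendZero w (i + 1) + φ z₁ * extendZero w i := by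
  simp only [Matrix.mulVec, dotProduct]
  rw [← sum_ite_val_eq, ← sum_ite_val_eq, Finset.mul_sum, Finset.mul_sum,
    ← Finset.sum_add_distrib]
  refine Finset.sum_congr rfl fun j _ => ?_
  simp only [superOnes, diagOnes, Matrix.map_apply, Matrix.add_apply, Matrix.smul_apply,
    Matrix.of_apply, smul_eq_mul]
  split_ifs <;> simp [add_mul]

theorem band_transpose_mulVec {p q : ℕ} (z₀ z₁ : ℂ[X]) (w : Fin p → R) (j : Fin q) :
    ((z₀ • (superOnes p q).map C + z₁ • (diagOnes p q).map C)ᵀ.map φ *ᵥ w) j =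
      φ z₀ * (if (j : ℕ) = 0 then 0 else extendZero w (j - 1)) + φ z₁ * extendZero w j := by
  have h : (if (j : ℕ) = 0 then 0 else extendZero w (j - 1)) =
      ∑ i : Fin p, (if (j : ℕ) = i + 1 then w i else 0) := by
    split_ifs with h0
    · exact (Finset.sum_eq_zero fun j _ => if_neg (by omega)).symm
    · rw [← sum_ite_val_eq]
      refine Finset.sum_congr rfl fun i _ => ?_
      congr 1
      exact propext (by omega)
  simp only [Matrix.mulVec, dotProduct]
  rw [h, ← sum_ite_val_eq, Finset.mul_sum, Finset.mul_sum, ← Finset.sum_add_distrib]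
  refine Finset.sum_congr rfl fun i _ => ?_
  simp only [superOnes, diagOnes, Matrix.map_apply, Matrix.add_apply, Matrix.smul_apply,
    Matrix.transpose_apply, Matrix.of_apply, smul_eq_mul]
  have hij : (i : ℕ) = j ↔ (j : ℕ) = i := eq_comm
  simp only [hij]
  split_ifs <;> simp [add_mul]

/-- Back substitution from the last coordinate, the extension by zero supplying the missing
superdiagonal term there. -/
theorem band_square_injective {k : ℕ} {z₀ z₁ : ℂ[X]} (hz : φ z₁ ≠ 0) (w : Fin k → R)
    (h : (z₀ • (superOnes k k).map C + z₁ • (diagOnes k k).map C).map φ *ᵥ w = 0) : w = 0 := by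
  have key : ∀ m i, k ≤ i + m → extendZero w i = 0 := by
    intro m
    induction m with
    | zero => exact fun i hi => extendZero_of_le w hi
    | succ m ih =>
      intro i hi
      by_cases hik : i < k
      · have := congrFun h ⟨i, hik⟩
        rw [band_mulVec, ih (i + 1) (by omega), mul_zero, zero_add] at this
        exact (mul_eq_zero.mp this).resolve_left hz
      · exact extendZero_of_le w (not_lt.mp hik)
  funext i
  rw [← extendZero_val w i]
  exact key k i (by omega)

theorem finiteBlock_injective (hφ : Function.Injective φ) (α : ℂ) {k : ℕ} (w : Fin k → R)
    (h : (finiteBlock α k).map φ *ᵥ w = 0) : w = 0 := by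
  rw [finiteBlock_eq] at h
  refine band_square_injective φ ?_ w h
  rw [map_ne_zero_iff φ hφ, ← neg_sub, neg_ne_zero]
  exact Polynomial.X_sub_C_ne_zero α

theorem infiniteBlock_injective {k : ℕ} (w : Fin k → R)
    (h : (infiniteBlock k).map φ *ᵥ w = 0) : w = 0 := by
  rw [infiniteBlock_eq] at h
  exact band_square_injective φ (by simp) w h

/-- Forward substitution: each row has `λ` on the diagonal and otherwise involves only the previous
coordinate. -/
theorem leftBlock_injective (hφ : Function.Injective φ) {η : ℕ} (w : Fin η → R)
    (h : (leftBlock η).map φ *ᵥ w = 0) : w = 0 := by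
  rw [leftBlock, rightBlock_eq] at h
  have hX : φ X ≠ 0 := (map_ne_zero_iff φ hφ).mpr Polynomial.X_ne_zero
  have key : ∀ i, i < η + 1 → extendZero w i = 0 := by
    intro i
    induction i with
    | zero =>
      intro hi
      have := congrFun h ⟨0, hi⟩
      rw [band_transpose_mulVec, if_pos rfl, mul_zero, zero_add] at this
      exact (mul_eq_zero.mp this).resolve_left hX
    | succ i ih =>
      intro hi
      have := congrFun h ⟨i + 1, hi⟩
      rw [band_transpose_mulVec, if_neg (by simp)] at this
      simp only [Nat.add_sub_cancel] at this
      rw [ih (by omega), mul_zero, zero_add] at this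
      exact (mul_eq_zero.mp this).resolve_left hX
  funext i
  rw [← extendZero_val w i]
  exact key i (by omega)

/-- The rows are the recursion `wⱼ₊₁ = -λ wⱼ`, so the first coordinate is free and determines the
rest. -/
theorem rightBlock_mulVec_eq_zero {ε : ℕ} (w : Fin (ε + 1) → R) :
    (rightBlock ε).map φ *ᵥ w = 0 ↔ ∀ j, w j = (-φ X) ^ (j : ℕ) * w 0 := by
  rw [rightBlock_eq]
  constructor
  · intro h
    have key : ∀ i, i < ε + 1 → extendZero w i = (-φ X) ^ i * w 0 := by
      intro i
      induction i with
      | zero =>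
        intro _
        rw [pow_zero, one_mul]
        exact extendZero_val w 0
      | succ i ih =>
        intro hi
        have := congrFun h ⟨i, by omega⟩
        rw [band_mulVec, ih (by omega), map_one, one_mul] at this
        rw [eq_neg_of_add_eq_zero_left this, pow_succ]
        ring
    intro j
    rw [← extendZero_val w j]
    exact key j j.2
  · intro h
    funext i
    rw [band_mulVec]
    have h1 := extendZero_val w i.succ
    have h2 := extendZero_val w i.castSucc
    rw [Fin.val_succ] at h1
    rw [Fin.val_castSucc] at h2
    rw [h1, h2, h i.succ, h i.castSucc, Fin.val_succ, Fin.val_castSucc, pow_succ, map_one]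
    simp only [Pi.zero_apply]
    ring

theorem dsum_mulVec_eq_zero (M : Matrix ι κ ℂ[X]) (N : Matrix ι' κ' ℂ[X]) (w : κ ⊕ κ' → R) :
    (dsum M N).map φ *ᵥ w = 0 ↔
      M.map φ *ᵥ (w ∘ Sum.inl) = 0 ∧ N.map φ *ᵥ (w ∘ Sum.inr) = 0 := by
  rw [dsum, fromBlocks_map, fromBlocks_mulVec]
  simp only [Matrix.map_zero _ (map_zero φ), Matrix.zero_mulVec, add_zero, zero_add]
  constructor
  · intro h
    exact ⟨funext fun i => congrFun h (Sum.inl i), funext fun i => congrFun h (Sum.inr i)⟩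
  · rintro ⟨h1, h2⟩
    rw [h1, h2]
    ext (i | i) <;> rfl

theorem blockDiagonal'_mulVec_eq_zero {a : ℕ} {r c : Fin a → ℕ}
    (F : ∀ i, Matrix (Fin (r i)) (Fin (c i)) ℂ[X]) (w : (Σ i, Fin (c i)) → R) :
    (blockDiagonal' F).map φ *ᵥ w = 0 ↔ ∀ i, (F i).map φ *ᵥ (fun j => w ⟨i, j⟩) = 0 := by
  have key : ∀ i j, ((blockDiagonal' F).map φ *ᵥ w) ⟨i, j⟩ =
      ((F i).map φ *ᵥ (fun j => w ⟨i, j⟩)) j := by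
    intro i j
    simp only [Matrix.mulVec, dotProduct, Fintype.sum_sigma]
    rw [Finset.sum_eq_single i]
    · simp [blockDiagonal'_apply_eq]
    · intro b _ hb
      exact Finset.sum_eq_zero fun x _ => by
        simp [blockDiagonal'_apply_ne F _ _ (Ne.symm hb)]
    · simp
  constructor
  · intro h i
    funext j
    rw [← key, h]
    rfl
  · intro h
    funext ⟨i, j⟩
    rw [key, h]
    rfl

theorem finitePart_injective (hφ : Function.Injective φ) {f : ℕ} (α : Fin f → ℂ) (k : Fin f → ℕ)
    (w : (Σ i, Fin (k i)) → R) (h : (finitePart α k).map φ *ᵥ w = 0) : w = 0 := by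
  funext ⟨i, j⟩
  exact congrFun (finiteBlock_injective φ hφ _ _ ((blockDiagonal'_mulVec_eq_zero φ _ w).mp h i)) j

theorem infinitePart_injective {g : ℕ} (l : Fin g → ℕ)
    (w : (Σ i, Fin (l i)) → R) (h : (infinitePart l).map φ *ᵥ w = 0) : w = 0 := by
  funext ⟨i, j⟩
  exact congrFun (infiniteBlock_injective φ _ ((blockDiagonal'_mulVec_eq_zero φ _ w).mp h i)) j

theorem leftPart_injective (hφ : Function.Injective φ) {b : ℕ} (η : Fin b → ℕ)
    (w : (Σ i, Fin (η i)) → R) (h : (leftPart η).map φ *ᵥ w = 0) : w = 0 := by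
  funext ⟨i, j⟩
  exact congrFun (leftBlock_injective φ hφ _ ((blockDiagonal'_mulVec_eq_zero φ _ w).mp h i)) j

theorem det_ne_zero_of_constEquiv_finitePart {s : ℕ} {M : Matrix (Fin s) (Fin s) ℂ[X]} {f : ℕ}
    {α : Fin f → ℂ} {k : Fin f → ℕ} (h : ConstEquiv M (finitePart α k)) : M.det ≠ 0 := by
  obtain ⟨U, U', V, V', h1, h2, h3, h4, hN⟩ := h
  rw [Ne, ← Matrix.exists_mulVec_eq_zero_iff]
  rintro ⟨x, hx, hx0⟩
  have hV : V.map C * V'.map (C : ℂ →+* ℂ[X]) = 1 := by rw [← map_C_mul, h3, map_C_one]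
  have h5 : (finitePart α k).map (RingHom.id ℂ[X]) *ᵥ (V'.map C *ᵥ x) = 0 := by
    rw [RingHom.coe_id, Matrix.map_id, ← hN, Matrix.mulVec_mulVec, Matrix.mul_assoc, hV,
      Matrix.mul_one, ← Matrix.mulVec_mulVec, hx0, Matrix.mulVec_zero]
  have h6 := finitePart_injective (RingHom.id ℂ[X]) Function.injective_id α k _ h5
  apply hx
  rw [← Matrix.one_mulVec x, ← hV, ← Matrix.mulVec_mulVec, h6, Matrix.mulVec_zero]

end Kernel

/-! ### Normal ranks of the canonical form and of the system pencil -/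

section NormalRank

variable {ι κ ι' κ' : Type*} [Fintype ι] [DecidableEq ι] [Fintype κ] [DecidableEq κ]
  [Fintype ι'] [DecidableEq ι'] [Fintype κ'] [DecidableEq κ']

theorem ConstEquiv.normalRank_le {M : Matrix ι κ ℂ[X]} {N : Matrix ι' κ' ℂ[X]}
    (h : ConstEquiv M N) : normalRank N ≤ normalRank M := by
  obtain ⟨U, U', V, V', h1, h2, h3, h4, rfl⟩ := h
  unfold normalRank
  rw [Matrix.map_mul, Matrix.map_mul]
  exact (Matrix.rank_mul_le_left _ _).trans (Matrix.rank_mul_le_right _ _)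

theorem ConstEquiv.normalRank_eq {M : Matrix ι κ ℂ[X]} {N : Matrix ι' κ' ℂ[X]}
    (h : ConstEquiv M N) : normalRank M = normalRank N :=
  le_antisymm h.symm.normalRank_le h.normalRank_le

theorem normalRank_add_finrank_ker (M : Matrix ι κ ℂ[X]) :
    normalRank M + Module.finrank (RatFunc ℂ)
      (LinearMap.ker (M.map (algebraMap ℂ[X] (RatFunc ℂ))).mulVecLin) = Fintype.card κ := by
  rw [normalRank, Matrix.rank, LinearMap.finrank_range_add_finrank_ker, Module.finrank_pi]

/-- Each right block contributes one dimension to the kernel, parametrized by its first coordinate;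
all other blocks are injective. -/
theorem normalRank_kroneckerForm {a f g b : ℕ} (ε : Fin a → ℕ) (α : Fin f → ℂ) (k : Fin f → ℕ)
    (l : Fin g → ℕ) (η : Fin b → ℕ) :
    normalRank (dsum (dsum (rightPart ε) (finitePart α k)) (dsum (infinitePart l) (leftPart η)))
      + a = Fintype.card (((Σ i, Fin (ε i + 1)) ⊕ (Σ i, Fin (k i))) ⊕
        ((Σ i, Fin (l i)) ⊕ (Σ i, Fin (η i)))) := by
  rw [← normalRank_add_finrank_ker (dsum (dsum (rightPart ε) (finitePart α k))
    (dsum (infinitePart l) (leftPart η)))]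
  congr 1
  set φ := algebraMap ℂ[X] (RatFunc ℂ) with hφ
  have hinj : Function.Injective φ := RatFunc.algebraMap_injective ℂ
  let L : (Fin a → RatFunc ℂ) →ₗ[RatFunc ℂ] (((Σ i, Fin (ε i + 1)) ⊕ (Σ i, Fin (k i))) ⊕
        ((Σ i, Fin (l i)) ⊕ (Σ i, Fin (η i))) → RatFunc ℂ) :=
    { toFun := fun c => Sum.elim (Sum.elim (fun ij => (-φ X) ^ (ij.2 : ℕ) * c ij.1) 0) 0
      map_add' := fun c c' => by
        ext ((i | i) | i) <;> simp [mul_add]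
      map_smul' := fun r c => by
        ext ((i | i) | i) <;> simp [mul_left_comm] }
  have hL : Function.Injective L := fun c c' h => funext fun i => by
    simpa [L] using congrFun h (Sum.inl (Sum.inl ⟨i, 0⟩))
  refine ((Module.finrank_fin_fun (RatFunc ℂ)).symm.trans
    (LinearMap.finrank_range_of_inj hL).symm).trans ?_
  suffices h : LinearMap.ker ((dsum (dsum (rightPart ε) (finitePart α k))
      (dsum (infinitePart l) (leftPart η))).map φ).mulVecLin = LinearMap.range L by rw [h]
  refine Submodule.ext fun w => ?_
  rw [LinearMap.mem_ker, Matrix.mulVecLin_apply, dsum_mulVec_eq_zero, dsum_mulVec_eq_zero,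
    dsum_mulVec_eq_zero, LinearMap.mem_range]
  symm
  constructor
  · rintro ⟨c, rfl⟩
    refine ⟨⟨(blockDiagonal'_mulVec_eq_zero φ _ _).mpr fun i =>
      (rightBlock_mulVec_eq_zero φ _).mpr fun j => ?_, ?_⟩, ?_, ?_⟩
    · simp [L]
    · exact Matrix.mulVec_zero _
    · exact Matrix.mulVec_zero _
    · exact Matrix.mulVec_zero _
  · rintro ⟨⟨h1, h2⟩, h3, h4⟩
    refine ⟨fun i => w (Sum.inl (Sum.inl ⟨i, 0⟩)), ?_⟩
    have h1' := (blockDiagonal'_mulVec_eq_zero φ _ _).mp h1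
    have h2' := finitePart_injective φ hinj α k _ h2
    have h3' := infinitePart_injective φ l _ h3
    have h4' := leftPart_injective φ hinj η _ h4
    funext x
    rcases x with (⟨i, j⟩ | x) | (x | x)
    · exact ((rightBlock_mulVec_eq_zero φ _).mp (h1' i) j).symm
    · exact (congrFun h2' x).symm
    · exact (congrFun h3' x).symm
    · exact (congrFun h4' x).symm

theorem shiftBlocks_mulVec {R : Type*} [CommRing R] (φ : ℂ[X] →+* R) (d n : ℕ)
    (w : Fin (d + 1) × Fin n → R) (i : Fin d) (j : Fin n) :
    ((shiftBlocks d n).map φ *ᵥ w) (i, j) = w (i.castSucc, j) - φ X * w (i.succ, j) := by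
  have : ∀ b, (shiftBlocks d n).map φ (i, j) b * w b =
      (if b = (i.castSucc, j) then w b else 0) - (if b = (i.succ, j) then φ X * w b else 0) := by
    rintro ⟨b, b'⟩
    have hne : ¬ i.castSucc = i.succ := (Fin.castSucc_lt_succ).ne
    simp only [shiftBlocks, Matrix.map_apply, Matrix.of_apply, Prod.mk.injEq]
    by_cases h : b' = j
    · subst h
      by_cases h1 : b = i.castSucc
      · subst h1; simp [hne]
      · by_cases h2 : b = i.succ
        · subst h2; simp [Ne.symm hne]
        · simp [h1, h2]
    · simp [h, Ne.symm h]
  simp only [Matrix.mulVec, dotProduct, this, Finset.sum_sub_distrib, Finset.sum_ite_eq',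
    Finset.mem_univ, if_true]

theorem coeffBlocks_mulVec {R : Type*} [CommRing R] (φ : ℂ[X] →+* R) {d m n : ℕ}
    {P : Matrix (Fin m) (Fin n) ℂ[X]} (hd : ∀ i j, (P i j).natDegree ≤ d) (y : Fin n → R) :
    (coeffBlocks d P).map φ *ᵥ (fun b => φ X ^ (b.1.rev : ℕ) * y b.2) = P.map φ *ᵥ y := by
  funext i
  simp only [Matrix.mulVec, dotProduct, Fintype.sum_prod_type_right, coeffBlocks, Matrix.map_apply,
    Matrix.of_apply]
  refine Finset.sum_congr rfl fun j _ => ?_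
  rw [← Equiv.sum_comp Fin.revPerm]
  conv_rhs => rw [(P i j).as_sum_range_C_mul_X_pow' (Nat.lt_succ_of_le (hd i j))]
  rw [map_sum, Finset.sum_mul, Finset.sum_range]
  refine Finset.sum_congr rfl fun x _ => ?_
  simp [mul_assoc]

/-- The shift rows force a null vector to be `(λ^d y, …, λ y, y)`, and on such a vector the
coefficient row evaluates to `P y`. The two nullities therefore agree. -/
theorem normalRank_systemPencil {d m n : ℕ} {P : Matrix (Fin m) (Fin n) ℂ[X]}
    (hd : ∀ i j, (P i j).natDegree ≤ d) :
    normalRank (systemPencil d P) + n = (d + 1) * n + normalRank P := by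
  set φ := algebraMap ℂ[X] (RatFunc ℂ) with hφ
  let L : (Fin n → RatFunc ℂ) →ₗ[RatFunc ℂ] (Fin (d + 1) × Fin n → RatFunc ℂ) :=
    { toFun := fun y b => φ X ^ (b.1.rev : ℕ) * y b.2
      map_add' := fun c c' => by ext; simp [mul_add]
      map_smul' := fun r c => by ext; simp [mul_left_comm] }
  have hL : Function.Injective L := fun c c' h => funext fun i => by
    simpa [L] using congrFun h (Fin.last d, i)
  have hker : LinearMap.ker ((fromRows (shiftBlocks d n) (coeffBlocks d P)).map φ).mulVecLin =
      (LinearMap.ker (P.map φ).mulVecLin).map L := by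
    ext w
    have hiff : (fromRows (shiftBlocks d n) (coeffBlocks d P)).map φ *ᵥ w = 0 ↔
        (shiftBlocks d n).map φ *ᵥ w = 0 ∧ (coeffBlocks d P).map φ *ᵥ w = 0 := by
      constructor
      · intro h
        exact ⟨funext fun i => congrFun h (Sum.inl i), funext fun i => congrFun h (Sum.inr i)⟩
      · rintro ⟨h1, h2⟩
        funext i
        rcases i with i | i
        · exact congrFun h1 i
        · exact congrFun h2 i
    rw [LinearMap.mem_ker, Matrix.mulVecLin_apply, hiff, Submodule.mem_map]
    constructor
    · rintro ⟨h1, h2⟩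
      have hw : L (fun j => w (Fin.last d, j)) = w := by
        funext ⟨i, j⟩
        change φ X ^ (i.rev : ℕ) * w (Fin.last d, j) = w (i, j)
        induction i using Fin.reverseInduction with
        | last => simp
        | cast i ih =>
          have h3 := congrFun h1 (i, j)
          rw [shiftBlocks_mulVec] at h3
          rw [sub_eq_zero.mp h3, ← ih, Fin.rev_castSucc, Fin.rev_succ, Fin.val_succ,
            Fin.val_castSucc, pow_succ]
          ring
      refine ⟨fun j => w (Fin.last d, j), ?_, hw⟩
      rw [LinearMap.mem_ker, Matrix.mulVecLin_apply, ← coeffBlocks_mulVec φ hd]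
      rw [← hw] at h2
      exact h2
    · rintro ⟨y, hy, rfl⟩
      refine ⟨?_, (coeffBlocks_mulVec φ hd y).trans hy⟩
      funext ⟨i, j⟩
      rw [shiftBlocks_mulVec]
      simp only [L, LinearMap.coe_mk, AddHom.coe_mk]
      rw [Fin.rev_castSucc, Fin.rev_succ, Fin.val_succ, Fin.val_castSucc, pow_succ]
      simp only [Pi.zero_apply]
      ring
  have h1 := normalRank_add_finrank_ker (fromRows (shiftBlocks d n) (coeffBlocks d P))
  have h2 := normalRank_add_finrank_ker P
  have h3 : normalRank (systemPencil d P) =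
      normalRank (fromRows (shiftBlocks d n) (coeffBlocks d P)) :=
    (ConstEquiv.of_reindex _ _ _).normalRank_eq.symm
  rw [hker, ← (Submodule.equivMapOfInjective L hL _).finrank_eq] at h1
  rw [← hφ] at h2
  simp only [Fintype.card_prod, Fintype.card_fin] at h1 h2
  omega

end NormalRank

/-! ### Unitary triangularization of row and column transformations -/

section Unitary

/-- Every square complex matrix is upper triangular after multiplication by a unitary matrix. -/
theorem exists_unitary_isUpperTriangular {N : ℕ} (Y : Matrix (Fin N) (Fin N) ℂ) :
    ∃ Q : Matrix.unitaryGroup (Fin N) ℂ,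
      ((Q : Matrix (Fin N) (Fin N) ℂ)ᴴ * Y).IsUpperTriangular := by
  let y : Fin N → EuclideanSpace ℂ (Fin N) := fun j => WithLp.toLp 2 fun i => Y i j
  let b := InnerProductSpace.gramSchmidtOrthonormalBasis (𝕜 := ℂ) (by simp) y
  refine ⟨⟨(EuclideanSpace.basisFun (Fin N) ℂ).toBasis.toMatrix b,
    OrthonormalBasis.toMatrix_orthonormalBasis_mem_unitary _ _⟩, fun i j hij => ?_⟩
  have h : inner ℂ (b i) (y j) = 0 :=
    InnerProductSpace.gramSchmidtOrthonormalBasis_inv_triangular (by simp) y hij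
  rw [PiLp.inner_apply] at h
  rw [Matrix.mul_apply, ← h]
  refine Finset.sum_congr rfl fun k _ => ?_
  simp [Module.Basis.toMatrix_apply, y, mul_comm]

/-- The row groups of sizes `p₁, p₂, p₃`. -/
def threeSplit {p₁ p₂ p₃ N : ℕ} (h : p₁ + p₂ + p₃ = N) :
    (Fin p₁ ⊕ Fin p₂) ⊕ Fin p₃ ≃ Fin N :=
  ((Equiv.sumCongr finSumFinEquiv (Equiv.refl _)).trans finSumFinEquiv).trans (finCongr h)

theorem exists_unitary_rows {N p₁ p₂ p₃ : ℕ} (hp : p₁ + p₂ + p₃ = N) {ρ₁ ρ₂ : Type}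
    [Fintype ρ₁] [Fintype ρ₂] (h₁ : Fintype.card ρ₁ = p₁) (h₂ : Fintype.card ρ₂ = p₂)
    (Y₁ : Matrix (Fin N) ρ₁ ℂ) (Y₂ : Matrix (Fin N) ρ₂ ℂ) :
    ∃ Q : Matrix.unitaryGroup (Fin N) ℂ,
      (∀ i a, ((Q : Matrix (Fin N) (Fin N) ℂ)ᴴ * Y₁) (threeSplit hp (Sum.inl (Sum.inr i))) a = 0) ∧
      (∀ i a, ((Q : Matrix (Fin N) (Fin N) ℂ)ᴴ * Y₁) (threeSplit hp (Sum.inr i)) a = 0) ∧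
      (∀ i a, ((Q : Matrix (Fin N) (Fin N) ℂ)ᴴ * Y₂) (threeSplit hp (Sum.inr i)) a = 0) := by
  let e₁ := Fintype.equivFinOfCardEq h₁
  let e₂ := Fintype.equivFinOfCardEq h₂
  -- Zero columns pad the matrix to a square one, as the triangularization requires.
  let Y : Matrix (Fin N) ((Fin p₁ ⊕ Fin p₂) ⊕ Fin p₃) ℂ := Matrix.of fun i =>
    Sum.elim (Sum.elim (fun j => Y₁ i (e₁.symm j)) fun j => Y₂ i (e₂.symm j)) 0
  obtain ⟨Q, hQ⟩ := exists_unitary_isUpperTriangular (Y.submatrix id (threeSplit hp).symm)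
  have h : ∀ i j, threeSplit hp j < i → ((Q : Matrix (Fin N) (Fin N) ℂ)ᴴ * Y) i j = 0 := by
    intro i j hij
    have := hQ hij
    simpa [Matrix.mul_apply] using this
  refine ⟨Q, fun i a => ?_, fun i a => ?_, fun i a => ?_⟩
  · have := h (threeSplit hp (Sum.inl (Sum.inr i))) (Sum.inl (Sum.inl (e₁ a))) (by
      simp [threeSplit, Fin.lt_def]; omega)
    simpa [Matrix.mul_apply, Y] using this
  · have := h (threeSplit hp (Sum.inr i)) (Sum.inl (Sum.inl (e₁ a))) (by
      simp [threeSplit, Fin.lt_def]; omega)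
    simpa [Matrix.mul_apply, Y] using this
  · have := h (threeSplit hp (Sum.inr i)) (Sum.inl (Sum.inr (e₂ a))) (by
      simp [threeSplit, Fin.lt_def]; omega)
    simpa [Matrix.mul_apply, Y] using this

/-- From the QR factorization `V = Z T` one gets `Z = V T⁻¹`, and `T⁻¹` is again upper triangular;
only the zero blocks needed later are recorded. -/
theorem exists_unitary_columns {N q₁ q₂ q₃ q₄ : ℕ} (hq : q₁ + q₂ + (q₃ + q₄) = N) {κ₁ κ₂ : Type}
    [Fintype κ₁] [DecidableEq κ₁] [Fintype κ₂] [DecidableEq κ₂]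
    (h₁ : Fintype.card κ₁ = q₁) (h₂ : Fintype.card κ₂ = q₂)
    (V : Matrix (Fin N) ((κ₁ ⊕ κ₂) ⊕ (Fin q₃ ⊕ Fin q₄)) ℂ)
    (V' : Matrix ((κ₁ ⊕ κ₂) ⊕ (Fin q₃ ⊕ Fin q₄)) (Fin N) ℂ) (hV : V * V' = 1) (hV' : V' * V = 1) :
    ∃ (Z : Matrix.unitaryGroup (Fin N) ℂ)
      (W₁₁ : Matrix κ₁ (Fin q₁) ℂ) (W₁₂ : Matrix κ₁ (Fin q₂) ℂ) (W₂₂ : Matrix κ₂ (Fin q₂) ℂ)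
      (W₁₃ : Matrix (κ₁ ⊕ κ₂) (Fin q₃ ⊕ Fin q₄) ℂ)
      (W₃₃ : Matrix (Fin q₃) (Fin q₃) ℂ) (W₃₄ : Matrix (Fin q₃) (Fin q₄) ℂ)
      (W₄₄ : Matrix (Fin q₄) (Fin q₄) ℂ)
      (W' : Matrix ((Fin q₁ ⊕ Fin q₂) ⊕ (Fin q₃ ⊕ Fin q₄))
        ((κ₁ ⊕ κ₂) ⊕ (Fin q₃ ⊕ Fin q₄)) ℂ),
      let W := fromBlocks (fromBlocks W₁₁ W₁₂ 0 W₂₂) W₁₃ 0 (fromBlocks W₃₃ W₃₄ 0 W₄₄)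
      (Z : Matrix (Fin N) (Fin N) ℂ).submatrix id (colSplit hq) = V * W ∧ W * W' = 1 ∧
        W' * W = 1 := by
  let e₁ := Fintype.equivFinOfCardEq h₁
  let e₂ := Fintype.equivFinOfCardEq h₂
  let e : (κ₁ ⊕ κ₂) ⊕ (Fin q₃ ⊕ Fin q₄) ≃ Fin N :=
    (Equiv.sumCongr (Equiv.sumCongr e₁ e₂) (Equiv.refl _)).trans (colSplit hq)
  let Y := V.submatrix id e.symm
  let Y' := V'.submatrix e.symm id
  have hY : Y * Y' = 1 := by
    rw [← hV]
    exact Matrix.submatrix_mul_equiv _ _ _ _ _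
  have hY' : Y' * Y = 1 := by
    have := Matrix.submatrix_mul V' V e.symm id e.symm Function.bijective_id
    rw [hV', Matrix.submatrix_one_equiv] at this
    exact this.symm
  obtain ⟨Q, hQ⟩ := exists_unitary_isUpperTriangular Y
  have hQ1 : (Q : Matrix (Fin N) (Fin N) ℂ) * (Q : Matrix (Fin N) (Fin N) ℂ)ᴴ = 1 :=
    Unitary.mul_star_self_of_mem Q.2
  have hQ2 : (Q : Matrix (Fin N) (Fin N) ℂ)ᴴ * (Q : Matrix (Fin N) (Fin N) ℂ) = 1 :=
    Unitary.star_mul_self_of_mem Q.2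
  have hT1 : ((Q : Matrix (Fin N) (Fin N) ℂ)ᴴ * Y) * (Y' * Q) = 1 := by
    rw [Matrix.mul_assoc, ← Matrix.mul_assoc Y, hY, Matrix.one_mul, hQ2]
  have hT2 : (Y' * Q) * ((Q : Matrix (Fin N) (Fin N) ℂ)ᴴ * Y) = 1 := by
    rw [Matrix.mul_assoc, ← Matrix.mul_assoc _ _ Y, hQ1, Matrix.one_mul, hY']
  have htri : (Y' * (Q : Matrix (Fin N) (Fin N) ℂ)).IsUpperTriangular := by
    let _ : Invertible ((Q : Matrix (Fin N) (Fin N) ℂ)ᴴ * Y) := ⟨_, hT2, hT1⟩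
    have := Matrix.blockTriangular_inv_of_blockTriangular hQ
    rwa [Matrix.inv_eq_right_inv hT1] at this
  let W := (Y' * (Q : Matrix (Fin N) (Fin N) ℂ)).submatrix e (colSplit hq)
  let W' := ((Q : Matrix (Fin N) (Fin N) ℂ)ᴴ * Y).submatrix (colSplit hq) e
  have hzero : ∀ i j, colSplit hq j < e i → W i j = 0 := fun i j hij => htri hij
  have hW : W = fromBlocks (fromBlocks W.toBlocks₁₁.toBlocks₁₁ W.toBlocks₁₁.toBlocks₁₂ 0
      W.toBlocks₁₁.toBlocks₂₂) W.toBlocks₁₂ 0 (fromBlocks W.toBlocks₂₂.toBlocks₁₁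
        W.toBlocks₂₂.toBlocks₁₂ 0 W.toBlocks₂₂.toBlocks₂₂) := by
    ext i j
    rcases i with (i | i) | (i | i) <;> rcases j with (j | j) | (j | j) <;>
      first
      | rfl
      | exact hzero _ _ (by simp [colSplit, e, Fin.lt_def]; omega)
  refine ⟨Q, W.toBlocks₁₁.toBlocks₁₁, W.toBlocks₁₁.toBlocks₁₂, W.toBlocks₁₁.toBlocks₂₂,
    W.toBlocks₁₂, W.toBlocks₂₂.toBlocks₁₁, W.toBlocks₂₂.toBlocks₁₂, W.toBlocks₂₂.toBlocks₂₂, W', ?_⟩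
  intro W₀
  rw [show W₀ = W from hW.symm]
  refine ⟨?_, ?_, ?_⟩
  · have h1 : V = Y.submatrix id e := by simp [Y]
    rw [h1, Matrix.submatrix_mul_equiv, ← Matrix.mul_assoc, hY, Matrix.one_mul]
  · rw [Matrix.submatrix_mul_equiv, hT2, Matrix.submatrix_one_equiv]
  · rw [Matrix.submatrix_mul_equiv, hT1, Matrix.submatrix_one_equiv]

/-- The triangular shape gives each diagonal block a one-sided inverse; matching cardinalities make
it two-sided. -/
theorem inverse_of_blockTriangular {ι₁ ι₂ κ₁ κ₂ : Type*}
    [Fintype ι₁] [DecidableEq ι₁] [Fintype κ₁] [DecidableEq κ₁]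
    [Fintype ι₂] [DecidableEq ι₂] [Fintype κ₂] [DecidableEq κ₂]
    {A : Matrix ι₁ κ₁ ℂ} {B : Matrix ι₁ κ₂ ℂ} {D : Matrix ι₂ κ₂ ℂ}
    {M : Matrix (κ₁ ⊕ κ₂) (ι₁ ⊕ ι₂) ℂ} (h₁ : fromBlocks A B 0 D * M = 1)
    (h₂ : M * fromBlocks A B 0 D = 1) (hc : Fintype.card ι₁ = Fintype.card κ₁) :
    (∃ A' : Matrix κ₁ ι₁ ℂ, A * A' = 1 ∧ A' * A = 1) ∧
      ∃ D' : Matrix κ₂ ι₂ ℂ, D * D' = 1 ∧ D' * D = 1 := by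
  have hc' := Matrix.square_of_invertible _ _ h₁ h₂
  simp only [Fintype.card_sum] at hc'
  rw [← fromBlocks_toBlocks M, fromBlocks_multiply, ← fromBlocks_one, fromBlocks_inj] at h₁ h₂
  have hA : M.toBlocks₁₁ * A = 1 := by simpa using h₂.1
  have hD : D * M.toBlocks₂₂ = 1 := by simpa using h₁.2.2.2
  exact ⟨⟨_, (Matrix.mul_eq_one_comm_of_card_eq _ _ _ hc.symm).mp hA, hA⟩,
    ⟨_, hD, (Matrix.mul_eq_one_comm_of_card_eq _ _ _ (by omega)).mp hD⟩⟩

end Unitary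

/-! ### Unitary block triangular form along a canonical decomposition -/

section Triangular

theorem pencil_mul_mul {ι κ ι' κ' : Type*} [Fintype ι] [Fintype κ] (U : Matrix ι' ι ℂ)
    (A E : Matrix ι κ ℂ) (V : Matrix κ κ' ℂ) :
    U.map C * pencil A E * V.map C = pencil (U * A * V) (U * E * V) := by
  simp [pencil, Matrix.mul_sub, Matrix.sub_mul]

theorem pencil_apply {ι κ : Type*} (A E : Matrix ι κ ℂ) (i : ι) (j : κ) :
    pencil A E i j = C (A i j) - X * C (E i j) := rfl

theorem coeff_zero_pencil {ι κ : Type*} (A E : Matrix ι κ ℂ) (i : ι) (j : κ) :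
    (pencil A E i j).coeff 0 = A i j := by
  simp [pencil]

/-- Only the diagonal blocks of the product matter for the Kronecker structure, so the others are
left existential. -/
theorem fromBlocks_mul_dsum_mul {ι₁ ι₂ ι₃ ρ₁ ρ₂ ρ₃ κ₁ κ₂ κ₃ μ₁ μ₂ μ₃ : Type*}
    [Fintype ρ₁] [Fintype ρ₂] [Fintype ρ₃] [Fintype κ₁] [Fintype κ₂] [Fintype κ₃]
    (R₁₁ : Matrix ι₁ ρ₁ ℂ) (R₁₂ : Matrix ι₁ ρ₂ ℂ) (R₂₂ : Matrix ι₂ ρ₂ ℂ)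
    (R₁₃ : Matrix (ι₁ ⊕ ι₂) ρ₃ ℂ) (R₃₃ : Matrix ι₃ ρ₃ ℂ)
    (K₁ : Matrix ρ₁ κ₁ ℂ[X]) (K₂ : Matrix ρ₂ κ₂ ℂ[X]) (K₃ : Matrix ρ₃ κ₃ ℂ[X])
    (W₁₁ : Matrix κ₁ μ₁ ℂ) (W₁₂ : Matrix κ₁ μ₂ ℂ) (W₂₂ : Matrix κ₂ μ₂ ℂ)
    (W₁₃ : Matrix (κ₁ ⊕ κ₂) μ₃ ℂ) (W₃₃ : Matrix κ₃ μ₃ ℂ) :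
    ∃ S₁₂ S₁₃, (fromBlocks (fromBlocks R₁₁ R₁₂ 0 R₂₂) R₁₃ 0 R₃₃).map C *
        dsum (dsum K₁ K₂) K₃ * (fromBlocks (fromBlocks W₁₁ W₁₂ 0 W₂₂) W₁₃ 0 W₃₃).map C =
      fromBlocks (fromBlocks (R₁₁.map C * K₁ * W₁₁.map C) S₁₂ 0 (R₂₂.map C * K₂ * W₂₂.map C))
        S₁₃ 0 (R₃₃.map C * K₃ * W₃₃.map C) := by
  refine ⟨R₁₁.map C * K₁ * W₁₂.map C + R₁₂.map C * K₂ * W₂₂.map C,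
    (fromBlocks R₁₁ R₁₂ 0 R₂₂).map C * dsum K₁ K₂ * W₁₃.map C + R₁₃.map C * K₃ * W₃₃.map C, ?_⟩
  simp only [dsum, fromBlocks_map, fromBlocks_multiply, map_C_zero, Matrix.mul_zero,
    Matrix.zero_mul, add_zero, zero_add]

theorem coeff_one_pencil {ι κ : Type*} (A E : Matrix ι κ ℂ) (i : ι) (j : κ) :
    (pencil A E i j).coeff 1 = - E i j := by
  simp [pencil, Polynomial.coeff_C]

/-- If the last rows of a pencil are constant, and every row of the leading part of a block
decomposition is detected by a `λ`-coefficient, then the leading part does not reach the last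
rows. -/
theorem last_rows_eq_zero {N m N' : ℕ} {A E : Matrix (Fin N ⊕ Fin m) (Fin N') ℂ}
    (hE : ∀ i j, E (Sum.inr i) j = 0) {ρ ρ' κ κ' : Type} [Fintype ρ] [DecidableEq ρ]
    [Fintype ρ'] [Fintype κ] [Fintype κ']
    {K : Matrix ρ κ ℂ[X]} {L : Matrix ρ' κ' ℂ[X]}
    (hlead : ∀ x, ∃ c, ∃ u : ℂ, u ≠ 0 ∧ ∀ x', (K x' c).coeff 1 = if x' = x then u else 0)
    {V : Matrix (Fin N') (κ ⊕ κ') ℂ} {Y : Matrix (Fin N ⊕ Fin m) (ρ ⊕ ρ') ℂ}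
    (h : pencil A E * V.map C = Y.map C * dsum K L) (i : Fin m) (x : ρ) :
    Y (Sum.inr i) (Sum.inl x) = 0 := by
  obtain ⟨c, u, hu, hc⟩ := hlead x
  have h1 := congrArg (fun p => p.coeff 1) (congrFun (congrFun h (Sum.inr i)) (Sum.inl c))
  have h2 : pencil A E * V.map C = pencil (A * V) (E * V) := by
    simp [pencil, Matrix.sub_mul]
  have h3 : (E * V) (Sum.inr i) (Sum.inl c) = 0 := by
    simp [Matrix.mul_apply, hE]
  rw [h2] at h1
  rw [coeff_one_pencil, h3, neg_zero] at h1
  simp only [Matrix.mul_apply, Fintype.sum_sum_type, dsum, fromBlocks_apply₁₁,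
    fromBlocks_apply₂₁, Matrix.zero_apply, mul_zero, Finset.sum_const_zero, add_zero,
    Polynomial.finsetSum_coeff, Matrix.map_apply, Polynomial.coeff_C_mul, hc,
    mul_ite, Finset.sum_ite_eq', Finset.mem_univ, if_true] at h1
  exact (mul_eq_zero.mp h1.symm).resolve_right hu

theorem rank_eq_of_injective {m q : ℕ} (M : Matrix (Fin m) (Fin q) ℂ)
    (h : ∀ x, M *ᵥ x = 0 → x = 0) : M.rank = q := by
  rw [Matrix.rank, LinearMap.finrank_range_of_inj ((injective_iff_map_eq_zero _).mpr h)]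
  simp

/-- Unitary reduction of a pencil with constant last rows to block triangular form, along a
decomposition whose leading part is detected by `λ`-coefficients. -/
theorem exists_unitary_blockTriangular {N m N' : ℕ} {A E : Matrix (Fin N ⊕ Fin m) (Fin N') ℂ}
    (hE : ∀ i j, E (Sum.inr i) j = 0) {ρ₁ ρ₂ ρ₃ κ₁ κ₃ : Type}
    [Fintype ρ₁] [DecidableEq ρ₁] [Fintype ρ₂] [DecidableEq ρ₂] [Fintype ρ₃] [DecidableEq ρ₃]
    [Fintype κ₁] [DecidableEq κ₁] [Fintype κ₃] [DecidableEq κ₃]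
    (K₁ : Matrix ρ₁ κ₁ ℂ[X]) (K₂ : Matrix ρ₂ ρ₂ ℂ[X]) (K₃ : Matrix ρ₃ κ₃ ℂ[X])
    (hK : ConstEquiv (pencil A E) (dsum (dsum K₁ K₂) K₃))
    (hlead : ∀ x, ∃ c, ∃ u : ℂ, u ≠ 0 ∧ ∀ x', (dsum K₁ K₂ x' c).coeff 1 = if x' = x then u else 0) :
    ∃ (Q : Matrix.unitaryGroup (Fin N) ℂ) (Z : Matrix.unitaryGroup (Fin N') ℂ)
      (p₁ p₃ q₁ s q₃ q₄ : ℕ) (hp : p₁ + s + p₃ = N) (hq : q₁ + s + (q₃ + q₄) = N')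
      (A₁₁ E₁₁ : Matrix (Fin p₁) (Fin q₁) ℂ) (A₁₂ E₁₂ : Matrix (Fin p₁) (Fin s) ℂ)
      (A₁₃ E₁₃ : Matrix (Fin p₁) (Fin q₃) ℂ) (A₁₄ E₁₄ : Matrix (Fin p₁) (Fin q₄) ℂ)
      (A₂₂ E₂₂ : Matrix (Fin s) (Fin s) ℂ)
      (A₂₃ E₂₃ : Matrix (Fin s) (Fin q₃) ℂ) (A₂₄ E₂₄ : Matrix (Fin s) (Fin q₄) ℂ)
      (A₃₃ E₃₃ : Matrix (Fin p₃) (Fin q₃) ℂ) (A₃₄ E₃₄ : Matrix (Fin p₃) (Fin q₄) ℂ)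
      (C₄ : Matrix (Fin m) (Fin q₄) ℂ),
      ((Matrix.fromBlocks (Q : Matrix (Fin N) (Fin N) ℂ)ᴴ 0 0
            (1 : Matrix (Fin m) (Fin m) ℂ)).map C * pencil A E *
          (Z : Matrix (Fin N') (Fin N') ℂ).map C).submatrix
            (rowSplit m hp) (colSplit hq) =
        Matrix.fromBlocks
          (Matrix.fromBlocks (pencil A₁₁ E₁₁) (pencil A₁₂ E₁₂) 0 (pencil A₂₂ E₂₂))
          (Matrix.fromBlocks (pencil A₁₃ E₁₃) (pencil A₁₄ E₁₄)
            (pencil A₂₃ E₂₃) (pencil A₂₄ E₂₄))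
          0
          (Matrix.fromBlocks (pencil A₃₃ E₃₃) (pencil A₃₄ E₃₄) 0 (C₄.map C)) ∧
      ConstEquiv K₁ (pencil A₁₁ E₁₁) ∧ ConstEquiv K₂ (pencil A₂₂ E₂₂) ∧
      ConstEquiv K₃
        (Matrix.fromBlocks (pencil A₃₃ E₃₃) (pencil A₃₄ E₃₄) 0 (C₄.map C)) ∧
      C₄.rank = q₄ := by
  obtain ⟨hcr, hcc⟩ := hK.card_eq
  obtain ⟨U, Y, V, V', hUY, hYU, hVV', hV'V, hK⟩ := hK
  have hSV : pencil A E * V.map C = Y.map C * dsum (dsum K₁ K₂) K₃ := by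
    rw [← hK, ← Matrix.mul_assoc, ← Matrix.mul_assoc, ← map_C_mul, hYU, map_C_one, Matrix.one_mul]
  have hY0 := last_rows_eq_zero hE hlead hSV
  simp only [Fintype.card_sum, Fintype.card_fin] at hcr hcc
  -- the leading part fits into the first `N` rows
  have hle : Fintype.card ρ₁ + Fintype.card ρ₂ ≤ N := by
    have hinj : U.toBlocks₁₁ * Y.toBlocks₁₁ = 1 := by
      have h1 := hUY
      rw [← fromBlocks_toBlocks U, ← fromBlocks_toBlocks Y, fromBlocks_multiply, ← fromBlocks_one,
        fromBlocks_inj] at h1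
      have h2 : Y.toBlocks₂₁ = 0 := Matrix.ext hY0
      simpa [h2] using h1.1
    have := card_le_of_injective ℂ Y.toBlocks₁₁.mulVecLin
      (Function.LeftInverse.injective (g := U.toBlocks₁₁.mulVecLin) fun x => by
        rw [Matrix.mulVecLin_apply, Matrix.mulVecLin_apply, Matrix.mulVec_mulVec, hinj,
          Matrix.one_mulVec])
    simpa using this
  obtain ⟨p₃, hp⟩ : ∃ p₃, Fintype.card ρ₁ + Fintype.card ρ₂ + p₃ = N := ⟨_, Nat.add_sub_cancel' hle⟩
  -- rows
  obtain ⟨Q, hQ1, hQ2, hQ3⟩ := exists_unitary_rows hp rfl rfl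
    (Y.submatrix Sum.inl (fun a => Sum.inl (Sum.inl a)))
    (Y.submatrix Sum.inl (fun a => Sum.inl (Sum.inr a)))
  set D : Matrix (Fin N ⊕ Fin m) (Fin N ⊕ Fin m) ℂ :=
    fromBlocks (Q : Matrix (Fin N) (Fin N) ℂ)ᴴ 0 0 1 with hD
  have hDl : ∀ i x, (D * Y) (Sum.inl i) x =
      ((Q : Matrix (Fin N) (Fin N) ℂ)ᴴ * Y.submatrix Sum.inl id) i x := by
    intro i x
    simp [hD, Matrix.mul_apply]
  have hDr : ∀ {κ : Type} (M : Matrix (Fin N ⊕ Fin m) κ ℂ) i x,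
      (D * M) (Sum.inr i) x = M (Sum.inr i) x := by
    intro κ M i x
    simp [hD, Matrix.mul_apply, Matrix.one_apply]
  obtain ⟨D', hD'⟩ : ∃ D' : Matrix (Fin N ⊕ Fin m) (Fin N ⊕ Fin m) ℂ,
    D' = fromBlocks (Q : Matrix (Fin N) (Fin N) ℂ) 0 0 1 := ⟨_, rfl⟩
  have hDD : D * D' = 1 := by
    have : (Q : Matrix (Fin N) (Fin N) ℂ)ᴴ * (Q : Matrix (Fin N) (Fin N) ℂ) = 1 :=
      Unitary.star_mul_self_of_mem Q.2
    simp [hD, hD', fromBlocks_multiply, this]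
  have hDD' : D' * D = 1 :=
    mul_eq_one_comm.mp hDD
  set R := (D * Y).submatrix (rowSplit m hp) id with hR
  set R' := (U * D').submatrix id (rowSplit m hp)
    with hR'
  have hRR' : R * R' = 1 := by
    rw [hR, hR', ← Matrix.submatrix_mul _ _ _ id _ Function.bijective_id, Matrix.mul_assoc,
      ← Matrix.mul_assoc Y, hYU, Matrix.one_mul, hDD, Matrix.submatrix_one_equiv]
  have hR'R : R' * R = 1 := by
    rw [hR, hR', Matrix.submatrix_mul_equiv, Matrix.mul_assoc, ← Matrix.mul_assoc _ D, hDD',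
      Matrix.one_mul, hUY, Matrix.submatrix_id_id]
  -- The zeros in the first `N` rows come from `Q`; those in the last `m` rows were already present
  -- in `Y` and survive because `D` is the identity there.
  have hRb : R = fromBlocks (fromBlocks R.toBlocks₁₁.toBlocks₁₁ R.toBlocks₁₁.toBlocks₁₂ 0
      R.toBlocks₁₁.toBlocks₂₂) R.toBlocks₁₂ 0 R.toBlocks₂₂ := by
    ext i j
    rcases i with (i | i) | (i | i)
    · rcases j with (j | j) | j <;> rfl
    · rcases j with (j | j) | j
      · exact (hDl _ _).trans (hQ1 i j)
      · rfl
      · rfl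
    · rcases j with (j | j) | j
      · exact (hDl _ _).trans (hQ2 i j)
      · exact (hDl _ _).trans (hQ3 i j)
      · rfl
    · rcases j with j | j
      · exact (hDr Y i _).trans (hY0 i j)
      · rfl
  -- columns
  obtain ⟨q₃, q₄, J, H, J', H', hJ1, hJ2, hJ3, hJ4⟩ := exists_column_compression
    (Matrix.of fun (i : Fin m) x => (A * V) (Sum.inr i) (Sum.inr x))
  have hJc := Matrix.square_of_invertible _ _ hJ1 hJ2
  simp only [Fintype.card_sum, Fintype.card_fin] at hJc
  have hq : Fintype.card κ₁ + Fintype.card ρ₂ + (q₃ + q₄) = N' := by omega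
  -- Only the trailing columns are changed: those in `J` are killed by the constant last rows, those
  -- in `H` are mapped injectively.
  obtain ⟨G, hG⟩ : ∃ G : Matrix ((κ₁ ⊕ ρ₂) ⊕ κ₃) ((κ₁ ⊕ ρ₂) ⊕ (Fin q₃ ⊕ Fin q₄)) ℂ,
    G = fromBlocks 1 0 0 (fromCols J H) := ⟨_, rfl⟩
  obtain ⟨G', hG'⟩ : ∃ G' : Matrix ((κ₁ ⊕ ρ₂) ⊕ (Fin q₃ ⊕ Fin q₄)) ((κ₁ ⊕ ρ₂) ⊕ κ₃) ℂ,
    G' = fromBlocks 1 0 0 (fromRows J' H') := ⟨_, rfl⟩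
  have hGG' : G * G' = 1 := by simp [hG, hG', fromBlocks_multiply, hJ1]
  have hG'G : G' * G = 1 := by
    rw [hG, hG', fromBlocks_multiply, hJ2]
    simp
  obtain ⟨Z, W₁₁, W₁₂, W₂₂, W₁₃, W₃₃, W₃₄, W₄₄, W', hZ, hWW', hW'W⟩ :=
    exists_unitary_columns hq rfl rfl (V * G) (G' * V')
      (by rw [Matrix.mul_assoc, ← Matrix.mul_assoc G, hGG', Matrix.one_mul, hVV'])
      (by rw [Matrix.mul_assoc, ← Matrix.mul_assoc V', hV'V, Matrix.one_mul, hG'G])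
  -- the diagonal blocks of both transformations are invertible
  have hRR'b := hRR'
  have hR'Rb := hR'R
  rw [hRb] at hRR'b hR'Rb
  obtain ⟨⟨R₁', hR1, hR1'⟩, ⟨R₃', hR3, hR3'⟩⟩ := inverse_of_blockTriangular hRR'b hR'Rb (by simp)
  obtain ⟨⟨R₁₁', hR11, hR11'⟩, ⟨R₂₂', hR22, hR22'⟩⟩ := inverse_of_blockTriangular hR1 hR1' (by simp)
  obtain ⟨⟨W₁', hW1, hW1'⟩, ⟨W₃', hW3, hW3'⟩⟩ := inverse_of_blockTriangular hWW' hW'W (by simp)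
  obtain ⟨⟨W₁₁', hW11, hW11'⟩, ⟨W₂₂', hW22, hW22'⟩⟩ := inverse_of_blockTriangular hW1 hW1' (by simp)
  obtain ⟨-, ⟨W₄₄', hW44, hW44'⟩⟩ := inverse_of_blockTriangular hW3 hW3' rfl
  -- the transformed pencil
  set W₃ : Matrix (Fin q₃ ⊕ Fin q₄) (Fin q₃ ⊕ Fin q₄) ℂ := fromBlocks W₃₃ W₃₄ 0 W₄₄ with hW₃
  obtain ⟨T, hT⟩ : ∃ T : Matrix ((κ₁ ⊕ ρ₂) ⊕ κ₃)
      ((Fin (Fintype.card κ₁) ⊕ Fin (Fintype.card ρ₂)) ⊕ (Fin q₃ ⊕ Fin q₄)) ℂ,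
      T = fromBlocks (fromBlocks W₁₁ W₁₂ 0 W₂₂) W₁₃ 0 (fromCols J H * W₃) := ⟨_, rfl⟩
  have hZT : (Z : Matrix (Fin N') (Fin N') ℂ).submatrix id (colSplit hq) = V * T := by
    rw [hZ, Matrix.mul_assoc, hG, fromBlocks_multiply, hT]
    simp
  set AN := (D * A * (Z : Matrix (Fin N') (Fin N') ℂ)).submatrix (rowSplit m hp) (colSplit hq)
    with hAN
  set EN := (D * E * (Z : Matrix (Fin N') (Fin N') ℂ)).submatrix (rowSplit m hp) (colSplit hq)
    with hEN
  have hpen : (D.map C * pencil A E * (Z : Matrix (Fin N') (Fin N') ℂ).map C).submatrix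
      (rowSplit m hp) (colSplit hq) = pencil AN EN := by
    rw [pencil_mul_mul]
    rfl
  have hprod : pencil AN EN = R.map C * dsum (dsum K₁ K₂) K₃ * T.map C := by
    rw [← hpen, Matrix.submatrix_mul _ _ _ id _ Function.bijective_id,
      Matrix.submatrix_mul _ _ _ id _ Function.bijective_id]
    have e1 : ((Z : Matrix (Fin N') (Fin N') ℂ).map C).submatrix id (colSplit hq) =
        V.map C * T.map (C : ℂ →+* ℂ[X]) := by
      rw [← map_C_mul, ← hZT]; rfl
    have e2 : R.map (C : ℂ →+* ℂ[X]) = (D.map C).submatrix (rowSplit m hp) id * Y.map C := by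
      have : R = D.submatrix (rowSplit m hp) id * Y := by
        rw [hR, Matrix.submatrix_mul _ _ _ id _ Function.bijective_id, Matrix.submatrix_id_id]
      rw [this, map_C_mul]; rfl
    rw [e1, e2, Matrix.submatrix_id_id, ← Matrix.mul_assoc, Matrix.mul_assoc _ (pencil A E), hSV]
    simp only [Matrix.mul_assoc]
  obtain ⟨X, Y', hblocks⟩ : ∃ X Y', pencil AN EN =
      fromBlocks (fromBlocks (R.toBlocks₁₁.toBlocks₁₁.map C * K₁ * W₁₁.map C) X 0
        (R.toBlocks₁₁.toBlocks₂₂.map C * K₂ * W₂₂.map C)) Y' 0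
        (R.toBlocks₂₂.map C * K₃ * (fromCols J H * W₃).map C) := by
    obtain ⟨S₁₂, S₁₃, h⟩ := fromBlocks_mul_dsum_mul R.toBlocks₁₁.toBlocks₁₁
      R.toBlocks₁₁.toBlocks₁₂ R.toBlocks₁₁.toBlocks₂₂ R.toBlocks₁₂ R.toBlocks₂₂ K₁ K₂ K₃
      W₁₁ W₁₂ W₂₂ W₁₃ (fromCols J H * W₃)
    rw [← hRb, ← hT] at h
    exact ⟨S₁₂, S₁₃, hprod.trans h⟩
  -- the last rows
  have hEN0 : ∀ i j, EN (Sum.inr (Sum.inr i)) j = 0 := by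
    intro i j
    change (D * E * (Z : Matrix (Fin N') (Fin N') ℂ)) (Sum.inr i) (colSplit hq j) = 0
    rw [Matrix.mul_assoc, hDr]
    simp [Matrix.mul_apply, hE]
  have hAV0 : ∀ i x, (A * V) (Sum.inr i) (Sum.inl x) = 0 := by
    intro i x
    have h1 := congrArg (fun p => p.coeff 0) (congrFun (congrFun hSV (Sum.inr i)) (Sum.inl x))
    have h2 : pencil A E * V.map C = pencil (A * V) (E * V) := by
      simp [pencil, Matrix.sub_mul]
    rw [h2, coeff_zero_pencil] at h1
    rw [h1, Matrix.mul_apply, Fintype.sum_sum_type]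
    simp [hY0, dsum]
  set C₃ : Matrix (Fin m) κ₃ ℂ := Matrix.of fun i x => (A * V) (Sum.inr i) (Sum.inr x) with hC₃
  -- Since `C₃ * J = 0` and `W₃` is block triangular, the last rows reduce to `[0, C₃ * H * W₄₄]`.
  -- The factor `W₄₄` is invertible, so `C₄` inherits injectivity from `C₃ * H`.
  have hAN0 : ∀ i j, AN (Sum.inr (Sum.inr i)) (Sum.inr j) =
      (fromCols (0 : Matrix (Fin m) (Fin q₃) ℂ) (C₃ * H * W₄₄)) i j := by
    intro i j
    have h1 : AN (Sum.inr (Sum.inr i)) (Sum.inr j) =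
        (A * V * T) (Sum.inr i) (Sum.inr j) := by
      change (D * A * (Z : Matrix (Fin N') (Fin N') ℂ)) (Sum.inr i) (colSplit hq (Sum.inr j)) = _
      rw [Matrix.mul_assoc, hDr, Matrix.mul_assoc A V, ← hZT]
      rfl
    have h2 : C₃ * (fromCols J H * W₃) = fromCols 0 (C₃ * H * W₄₄) := by
      rw [← Matrix.mul_assoc, mul_fromCols, hJ3, hW₃, fromCols_mul_fromBlocks]
      simp
    rw [h1, ← h2, hT, Matrix.mul_apply, Matrix.mul_apply, Fintype.sum_sum_type]
    simp [hAV0, hC₃]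
  have hmain : pencil AN EN =
      fromBlocks (fromBlocks (pencil AN.toBlocks₁₁.toBlocks₁₁ EN.toBlocks₁₁.toBlocks₁₁)
        (pencil AN.toBlocks₁₁.toBlocks₁₂ EN.toBlocks₁₁.toBlocks₁₂) 0
        (pencil AN.toBlocks₁₁.toBlocks₂₂ EN.toBlocks₁₁.toBlocks₂₂))
      (fromBlocks (pencil AN.toBlocks₁₂.toBlocks₁₁ EN.toBlocks₁₂.toBlocks₁₁)
        (pencil AN.toBlocks₁₂.toBlocks₁₂ EN.toBlocks₁₂.toBlocks₁₂)
        (pencil AN.toBlocks₁₂.toBlocks₂₁ EN.toBlocks₁₂.toBlocks₂₁)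
        (pencil AN.toBlocks₁₂.toBlocks₂₂ EN.toBlocks₁₂.toBlocks₂₂)) 0
      (fromBlocks (pencil AN.toBlocks₂₂.toBlocks₁₁ EN.toBlocks₂₂.toBlocks₁₁)
        (pencil AN.toBlocks₂₂.toBlocks₁₂ EN.toBlocks₂₂.toBlocks₁₂) 0
        ((C₃ * H * W₄₄).map C)) := by
    refine Matrix.ext fun i j => ?_
    rcases i with (i | i) | (i | i)
    · rcases j with (j | j) | (j | j) <;> rfl
    · rcases j with (j | j) | (j | j)
      · rw [hblocks]; rfl
      · rfl
      · rfl
      · rfl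
    · rcases j with j | (j | j)
      · rw [hblocks]; rfl
      · rfl
      · rfl
    · rcases j with j | (j | j)
      · rw [hblocks]; rfl
      · change pencil AN EN _ _ = 0
        rw [pencil_apply, hEN0, hAN0]
        simp
      · change pencil AN EN _ _ = C ((C₃ * H * W₄₄) i j)
        rw [pencil_apply, hEN0, hAN0]
        simp
  have hcmp := hblocks.symm.trans hmain
  rw [fromBlocks_inj, fromBlocks_inj] at hcmp
  obtain ⟨⟨hc1, -, -, hc2⟩, -, -, hc3⟩ := hcmp
  refine ⟨Q, Z, _, p₃, _, _, q₃, q₄, hp, hq, _, _, _, _, _, _, _, _, _, _, _, _, _, _, _, _, _, _, _,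
    hpen.trans hmain, ⟨_, R₁₁', _, W₁₁', hR11, hR11', hW11, hW11', hc1⟩,
    ⟨_, R₂₂', _, W₂₂', hR22, hR22', hW22, hW22', hc2⟩,
    ⟨_, R₃', _, W₃' * fromRows J' H', hR3, hR3', ?_, ?_, hc3⟩, rank_eq_of_injective _ fun x hx => ?_⟩
  · rw [Matrix.mul_assoc, ← Matrix.mul_assoc W₃, hW3, Matrix.one_mul, hJ1]
  · rw [Matrix.mul_assoc, ← Matrix.mul_assoc _ _ W₃, hJ2, Matrix.one_mul, hW3']
  · rw [← Matrix.mulVec_mulVec] at hx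
    rw [← Matrix.one_mulVec x, ← hW44', ← Matrix.mulVec_mulVec, hJ4 _ hx, Matrix.mulVec_zero]

end Triangular

/-! ### Application to the system pencil -/

/-- The system pencil is a matrix pencil with constant last rows. -/
theorem exists_systemPencil_eq_pencil (d : ℕ) {m n : ℕ} (P : Matrix (Fin m) (Fin n) ℂ[X]) :
    ∃ A E : Matrix (Fin (d * n) ⊕ Fin m) (Fin ((d + 1) * n)) ℂ,
      systemPencil d P = pencil A E ∧ ∀ i j, E (Sum.inr i) j = 0 := by
  refine ⟨(systemPencil d P).map fun p => p.coeff 0, (systemPencil d P).map fun p => -p.coeff 1,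
    Matrix.ext fun i j => ?_, fun i j => ?_⟩
  · rw [pencil_apply]
    rcases i with i | i
    · simp only [systemPencil, shiftBlocks, Matrix.map_apply, Matrix.submatrix_apply,
        Equiv.sumCongr_apply, Sum.map_inl, fromRows_apply_inl, Matrix.of_apply]
      split_ifs <;> simp [Polynomial.coeff_one]
    · simp [systemPencil, coeffBlocks]
  · simp [systemPencil, coeffBlocks]

/-- Each row of the right and finite part is detected by the `λ`-coefficient of some column. -/
theorem exists_column_coeff_one {a f : ℕ} (ε : Fin a → ℕ) (α : Fin f → ℂ) (k : Fin f → ℕ)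
    (x : (Σ i, Fin (ε i)) ⊕ (Σ i, Fin (k i))) :
    ∃ c, ∃ u : ℂ, u ≠ 0 ∧
      ∀ x', (dsum (rightPart ε) (finitePart α k) x' c).coeff 1 = if x' = x then u else 0 := by
  rcases x with ⟨i, j⟩ | ⟨i, j⟩
  -- The diagonal column of row `j` carries `λ` in that row only; its possible superdiagonal entry
  -- is constant. The finite blocks behave alike, with `-λ`.
  · refine ⟨Sum.inl ⟨i, j.castSucc⟩, 1, one_ne_zero, ?_⟩
    rintro (⟨i', j'⟩ | x')
    · by_cases h : i' = i
      · subst h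
        simp only [dsum, fromBlocks_apply₁₁, rightPart, blockDiagonal'_apply_eq, rightBlock,
          Matrix.of_apply, Fin.ext_iff, Fin.val_castSucc, Fin.val_succ, Sum.inl.injEq,
          Sigma.mk.injEq, heq_eq_eq, true_and, eq_comm (a := (j : ℕ))]
        split_ifs <;> simp [Polynomial.coeff_one]
      · simp [dsum, rightPart, blockDiagonal'_apply_ne _ _ _ h, h]
    · simp [dsum]
  · refine ⟨Sum.inr ⟨i, j⟩, -1, by simp, ?_⟩
    rintro (x' | ⟨i', j'⟩)
    · simp [dsum]
    · by_cases h : i' = i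
      · subst h
        simp only [dsum, fromBlocks_apply₂₂, finitePart, blockDiagonal'_apply_eq, finiteBlock,
          Matrix.of_apply, Fin.ext_iff, Sum.inr.injEq,
          Sigma.mk.injEq, heq_eq_eq, true_and, eq_comm (a := (j : ℕ))]
        split_ifs <;> simp [Polynomial.coeff_one]
      · simp [dsum, finitePart, blockDiagonal'_apply_ne _ _ _ h, h]

/-- The Kronecker canonical form of the system pencil, with the numbers of right and left
Kronecker blocks expressed by the normal rank. -/
theorem exists_kroneckerForm_systemPencil {m n d r : ℕ} {P : Matrix (Fin m) (Fin n) ℂ[X]}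
    (hd : ∀ i j, (P i j).natDegree ≤ d) (hr : normalRank P = r) :
    ∃ (ε : Fin (n - r) → ℕ) (η : Fin (m - r) → ℕ)
      (f : ℕ) (α : Fin f → ℂ) (k : Fin f → ℕ) (g : ℕ) (l : Fin g → ℕ),
      (∀ i, 0 < k i) ∧ (∀ i, 0 < l i) ∧
      ConstEquiv (systemPencil d P)
        (dsum (dsum (rightPart ε) (finitePart α k)) (dsum (infinitePart l) (leftPart η))) := by
  obtain ⟨A, E, hS, -⟩ := exists_systemPencil_eq_pencil d P
  obtain ⟨a, f, g, b, ε, α, k, l, η, hk, hl, h⟩ := hasKroneckerForm_pencil _ A E rfl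
  rw [← hS] at h
  have h1 := normalRank_systemPencil hd
  have h2 := normalRank_kroneckerForm ε α k l η
  have h3 := h.normalRank_eq
  obtain ⟨h4, h5⟩ := h.card_eq
  rw [← h5] at h2
  have hrm : r ≤ m := hr ▸ (Matrix.rank_le_card_height _).trans_eq (Fintype.card_fin m)
  have hrn : r ≤ n := hr ▸ (Matrix.rank_le_card_width _).trans_eq (Fintype.card_fin n)
  simp only [Fintype.card_sum, Fintype.card_sigma, Fintype.card_fin, Finset.sum_add_distrib,
    Finset.sum_const, Finset.card_univ, smul_eq_mul, mul_one] at h2 h4 h5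
  have hmul : (d + 1) * n = d * n + n := by ring
  -- The nullity gives `a = n - r`, and the excess of rows over columns gives `b - a = m - n`; `r ≤
  -- m` and `r ≤ n` keep the truncated subtractions honest.
  obtain rfl : a = n - r := by omega
  obtain rfl : b = m - r := by omega
  exact ⟨ε, η, f, α, k, g, l, hk, hl, h⟩

end KroneckerPencil

theorem theorem4p1 (m n d r : ℕ) (P : Matrix (Fin m) (Fin n) ℂ[X])
    (hd : ∀ i j, (P i j).natDegree ≤ d) (hr : normalRank P = r) :
    ∃ (Q : Matrix.unitaryGroup (Fin (d * n)) ℂ)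
      (Z : Matrix.unitaryGroup (Fin ((d + 1) * n)) ℂ)
      -- sizes of the blocks
      (p₁ p₃ q₁ s q₃ q₄ : ℕ) (hp : p₁ + s + p₃ = d * n)
      (hq : q₁ + s + (q₃ + q₄) = (d + 1) * n)
      -- the blocks
      (A₁₁ E₁₁ : Matrix (Fin p₁) (Fin q₁) ℂ) (A₁₂ E₁₂ : Matrix (Fin p₁) (Fin s) ℂ)
      (A₁₃ E₁₃ : Matrix (Fin p₁) (Fin q₃) ℂ) (A₁₄ E₁₄ : Matrix (Fin p₁) (Fin q₄) ℂ)
      (A₂₂ E₂₂ : Matrix (Fin s) (Fin s) ℂ)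
      (A₂₃ E₂₃ : Matrix (Fin s) (Fin q₃) ℂ) (A₂₄ E₂₄ : Matrix (Fin s) (Fin q₄) ℂ)
      (A₃₃ E₃₃ : Matrix (Fin p₃) (Fin q₃) ℂ) (A₃₄ E₃₄ : Matrix (Fin p₃) (Fin q₄) ℂ)
      (C₄ : Matrix (Fin m) (Fin q₄) ℂ)
      -- the Kronecker structure: right and left minimal indices, finite zeros with their
      -- partial multiplicities, degrees of the infinite elementary divisors
      (ε : Fin (n - r) → ℕ) (η : Fin (m - r) → ℕ)
      (f : ℕ) (α : Fin f → ℂ) (k : Fin f → ℕ) (g : ℕ) (l : Fin g → ℕ),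
      -- the block triangular form of `(Q^* ⊕ I_m) S_λ Z`
      (((Matrix.fromBlocks (Q : Matrix (Fin (d * n)) (Fin (d * n)) ℂ)ᴴ 0 0
            (1 : Matrix (Fin m) (Fin m) ℂ)).map C * systemPencil d P *
          (Z : Matrix (Fin ((d + 1) * n)) (Fin ((d + 1) * n)) ℂ).map C).submatrix
            (rowSplit m hp) (colSplit hq) =
        Matrix.fromBlocks
          (Matrix.fromBlocks (pencil A₁₁ E₁₁) (pencil A₁₂ E₁₂) 0 (pencil A₂₂ E₂₂))
          (Matrix.fromBlocks (pencil A₁₃ E₁₃) (pencil A₁₄ E₁₄)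
            (pencil A₂₃ E₂₃) (pencil A₂₄ E₂₄))
          0
          (Matrix.fromBlocks (pencil A₃₃ E₃₃) (pencil A₃₄ E₃₄) 0 (C₄.map C))) ∧
      -- the Kronecker canonical form of `S_λ`
      (∀ i, 0 < k i) ∧ (∀ i, 0 < l i) ∧
      StrictEquiv (systemPencil d P)
        (dsum (dsum (rightPart ε) (finitePart α k)) (dsum (infinitePart l) (leftPart η))) ∧
      -- distribution of the Kronecker structure over the diagonal blocks
      (pencil A₂₂ E₂₂).det ≠ 0 ∧ StrictEquiv (pencil A₂₂ E₂₂) (finitePart α k) ∧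
      StrictEquiv (pencil A₁₁ E₁₁) (rightPart ε) ∧
      StrictEquiv (Matrix.fromBlocks (pencil A₃₃ E₃₃) (pencil A₃₄ E₃₄) 0 (C₄.map C))
        (dsum (infinitePart l) (leftPart η)) ∧
      -- full column rank
      C₄.rank = q₄ := by
  obtain ⟨ε, η, f, α, k, g, l, hk, hl, h⟩ := exists_kroneckerForm_systemPencil hd hr
  obtain ⟨A, E, hS, hE⟩ := exists_systemPencil_eq_pencil d P
  obtain ⟨Q, Z, p₁, p₃, q₁, s, q₃, q₄, hp, hq, A₁₁, E₁₁, A₁₂, E₁₂, A₁₃, E₁₃, A₁₄, E₁₄, A₂₂, E₂₂,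
    A₂₃, E₂₃, A₂₄, E₂₄, A₃₃, E₃₃, A₃₄, E₃₄, C₄, hmain, h₁, h₂, h₃, hC⟩ :=
    exists_unitary_blockTriangular hE _ _ _ (hS ▸ h) (exists_column_coeff_one ε α k)
  rw [← hS] at hmain
  exact ⟨Q, Z, p₁, p₃, q₁, s, q₃, q₄, hp, hq, A₁₁, E₁₁, A₁₂, E₁₂, A₁₃, E₁₃, A₁₄, E₁₄, A₂₂, E₂₂,
    A₂₃, E₂₃, A₂₄, E₂₄, A₃₃, E₃₃, A₃₄, E₃₄, C₄, ε, η, f, α, k, g, l, hmain, hk, hl, h.strictEquiv,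
    det_ne_zero_of_constEquiv_finitePart h₂.symm, h₂.symm.strictEquiv, h₁.symm.strictEquiv,
    h₃.symm.strictEquiv, hC⟩
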